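/- Let $n>2$, $\nu=n-1$, and let $y=(y_{1i},y_{2i})_{i=1}^n$ be real data whose sample covariance matrix $S$ (divisor $n-1$) is positive definite. Put $r=S_{12}/\sqrt{S_{11}S_{22}}$ and $l=\sqrt{S_{22}/S_{11}}$. Model. Given $(\mu_1,\alpha,\beta,\tau^2,\sigma_1^2,\sigma_2^2)$, the pairs $(y_{1i},y_{2i})$ are independent bivariate normal with mean $(\mu_1,\alpha+\beta\mu_1)$ and covariance $$\Sigma=\begin{pmatrix}\tau^2+\sigma_1^2&\beta\tau^2\\ \beta\tau^2&\beta^2\tau^2+\sigma_2^2\end{pmatrix}.$$ Prior. Let $\kappa_0>0$, $-1<\rho_0<1$, $\nu_0>0$, and $\Psi_0(\beta)=\nu_0\kappa_0^2\begin{pmatrix}1&\rho_0\beta\\ \rho_0\beta&\beta^2\end{pmatrix}$. For $\beta\neq0$ let $R_\beta$ be the set of positive definite symmetric $2\times2$ matrices $\Sigma$ with $\Sigma_{12}/\beta\ge0$, $\Sigma_{11}-\Sigma_{12}/\beta\ge0$ and $\Sigma_{22}-\beta\Sigma_{12}\ge0$, and let $$p(\Sigma\mid\beta)=K(\beta,\nu_0,\Psi_0(\beta))^{-1}|\Sigma|^{-(\nu_0+3)/2}e^{-\frac12\operatorname{tr}(\Psi_0(\beta)\Sigma^{-1})}\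 \text{ on } R_\beta,\qquad K(\beta,\nu_0,\Psi)=\int_{R_\beta}|\Sigma|^{-(\nu_0+3)/2}e^{-\frac12\operatorname{tr}(\Psi\Sigma^{-1})}\,d\Sigma ,$$ with $d\Sigma=d\Sigma_{11}\,d\Sigma_{12}\,d\Sigma_{22}$. The conditional prior density of $(\mu_1,\alpha,\tau^2,\sigma_1^2,\sigma_2^2)$ given $\beta$ is $c\,|\beta|\,p(\Sigma\mid\beta)$ with a constant $c>0$ (so it is constant in the location parameters), and $\beta$ has an arbitrary proper prior density $p(\beta)$ on $\mathbb R$. Let $p(y\mid\beta)$ be the integral of the sampling density times this conditional prior over $(\mu_1,\alpha)\in\mathbb R^2$ and $\tau^2,\sigma_1^2,\sigma_2^2\ge0$, and let $p_{\nu_0}(\beta\mid y)=p(y\mid\beta)p(\beta)/\int_{-\infty}^{\infty} p(y\mid b)p(b)\,db$ be the marginal posterior density. The function $J$. Let $p_t(\cdot\,;\nu)$ be the Student $t$ density with $\nu$ degrees of freedom, let $P_F(\cdot\,;\nu_1,\nu_2)$ be the $F$ cumulative distribution function, and set $$t_-(\nu,r)=\frac{-\sqrt\nu\,r}{\sqrt{1-r^2}},\quad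 t_+(b,\nu,r)=\frac{\sqrt\nu\,(b-r)}{\sqrt{1-r^2}},\quad F(t,b,\nu,r)=\frac{\nu-1}{\nu+1}\,\frac{\nu+t^2}{[t_+(b,\nu,r)-t_-(\nu,r)]^2-[t-t_-(\nu,r)]^2},$$ $$I(b,\nu,r)=\int_{t_-(\nu,r)}^{t_+(b,\nu,r)}p_t(t;\nu)\,P_F(F(t,b,\nu,r);\nu+1,\nu-1)\,dt,$$ $$J(\beta,\nu,r,l)=I(|\beta|/l,\nu,r\operatorname{sign}\beta)+I(l/|\beta|,\nu,r\operatorname{sign}\beta).$$ Claim. (1) For every $\nu_0>0$, the conditional prior and the posterior are well defined: for $\beta\ne0$ the integrals defining $K(\beta,\nu_0,\Psi_0(\beta))$ and $p(y\mid\beta)$ converge and $K(\beta,\nu_0,\Psi_0(\beta))>0$; moreover $0<\int_{-\infty}^{\infty} p(y\mid\beta)p(\beta)\,d\beta<\infty$. (2) The limiting density is well defined: the density of the $F$ distribution with $\nu+1$ and $\nu-1$ degrees of freedom is integrable, the two integrals in $J(\beta,\nu,r,l)$ converge for $\beta\neq0$, and $0<\int_{-\infty}^\infty p(\beta)J(\beta,\nu,r,l)\,d\beta<\infty$.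 (3) For every $\beta\neq0$, $$\lim_{\nu_0\downarrow0}p_{\nu_0}(\beta\mid y)=\frac{p(\beta)J(\beta,\nu,r,l)}{\int_{-\infty}^\infty p(b)J(b,\nu,r,l)\,db}.$$ (4) The limit depends on the data only through $r$ and $l$: any other data set of size $n$ with positive definite sample covariance matrix and the same $r$ and $l$ leads to the same limit. -/

import Mathlib

open MeasureTheory Filter Topology

noncomputable section

namespace EIV

/-! ### Data -/

/-- Sample mean. -/
def sampleMean {n : ℕ} (x : Fin n → ℝ) : ℝ := (∑ i, x i) / n

/-- Sample covariance of two coordinates, with divisor `n - 1`. -/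
def sampleCov {n : ℕ} (x z : Fin n → ℝ) : ℝ :=
  (∑ i, (x i - sampleMean x) * (z i - sampleMean z)) / ((n : ℝ) - 1)

/-- Sample covariance matrix `S`. -/
def covS {n : ℕ} (y₁ y₂ : Fin n → ℝ) : Matrix (Fin 2) (Fin 2) ℝ :=
  !![sampleCov y₁ y₁, sampleCov y₁ y₂; sampleCov y₁ y₂, sampleCov y₂ y₂]

/-- Sample correlation coefficient `r`. -/
def sampleCorr {n : ℕ} (y₁ y₂ : Fin n → ℝ) : ℝ :=
  sampleCov y₁ y₂ / Real.sqrt (sampleCov y₁ y₁ * sampleCov y₂ y₂)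

/-- Ratio of sample standard deviations `l`. -/
def sdRatio {n : ℕ} (y₁ y₂ : Fin n → ℝ) : ℝ :=
  Real.sqrt (sampleCov y₂ y₂ / sampleCov y₁ y₁)

/-! ### Sampling model -/

/-- Density at `(x₁, x₂)` of the bivariate normal law with mean `(m₁, m₂)` and covariance `Σ`. -/
def normalDensity (m₁ m₂ : ℝ) (Sig : Matrix (Fin 2) (Fin 2) ℝ) (x₁ x₂ : ℝ) : ℝ :=
  (2 * Real.pi)⁻¹ * Sig.det ^ (-(1 / 2) : ℝ) *
    Real.exp (-(1 / 2) * (![x₁ - m₁, x₂ - m₂] ⬝ᵥ (Sig⁻¹).mulVec ![x₁ - m₁, x₂ - m₂]))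

/-- Covariance of an observation: `τ2`, `s1`, `s2` are the variances `τ²`, `σ₁²`, `σ₂²`. -/
def covModel (β τ2 s1 s2 : ℝ) : Matrix (Fin 2) (Fin 2) ℝ :=
  !![τ2 + s1, β * τ2; β * τ2, β ^ 2 * τ2 + s2]

/-- Sampling density of `n` independent observations given all six parameters. -/
def samplingDensity {n : ℕ} (y₁ y₂ : Fin n → ℝ) (μ₁ α β τ2 s1 s2 : ℝ) : ℝ :=
  ∏ i, normalDensity μ₁ (α + β * μ₁) (covModel β τ2 s1 s2) (y₁ i) (y₂ i)

/-! ### Prior -/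

/-- The symmetric matrix with entries `Σ₁₁ = s.1`, `Σ₁₂ = s.2.1`, `Σ₂₂ = s.2.2`. -/
def symMat (s : ℝ × ℝ × ℝ) : Matrix (Fin 2) (Fin 2) ℝ :=
  !![s.1, s.2.1; s.2.1, s.2.2]

/-- Positive definite `Σ` that satisfy the nonnegativity conditions
`τ² ≥ 0`, `σ₁² ≥ 0`, `σ₂² ≥ 0` for the slope `β`. -/
def region (β : ℝ) : Set (Matrix (Fin 2) (Fin 2) ℝ) :=
  {Sig | Sig.PosDef ∧ 0 ≤ 1 / β * Sig 0 1 ∧ 0 ≤ Sig 0 0 - 1 / β * Sig 0 1 ∧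
    0 ≤ Sig 1 1 - β * Sig 0 1}

/-- Unnormalized inverted Wishart density. -/
def iwKernel (ν : ℝ) (Psi Sig : Matrix (Fin 2) (Fin 2) ℝ) : ℝ :=
  Sig.det ^ (-(ν + 3) / 2) * Real.exp (-(1 / 2) * (Psi * Sig⁻¹).trace)

/-- Normalization factor `K(β, ν, Ψ)`: integral of the kernel over the region,
with respect to `dΣ₁₁ dΣ₁₂ dΣ₂₂`. -/
def normK (β ν : ℝ) (Psi : Matrix (Fin 2) (Fin 2) ℝ) : ℝ :=
  ∫ s in {s : ℝ × ℝ × ℝ | symMat s ∈ region β}, iwKernel ν Psi (symMat s)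

/-- Precision matrix `Ψ₀(β)`. -/
def precision (ν₀ κ₀ ρ₀ β : ℝ) : Matrix (Fin 2) (Fin 2) ℝ :=
  (ν₀ * κ₀ ^ 2) • !![1, ρ₀ * β; ρ₀ * β, β ^ 2]

open Classical in
/-- Conditional prior density `p(Σ ∣ β)`, supported on the region. -/
def priorSigma (ν₀ κ₀ ρ₀ β : ℝ) (Sig : Matrix (Fin 2) (Fin 2) ℝ) : ℝ :=
  if Sig ∈ region β then
    (normK β ν₀ (precision ν₀ κ₀ ρ₀ β))⁻¹ * iwKernel ν₀ (precision ν₀ κ₀ ρ₀ β) Sig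
  else 0

/-- Conditional prior density of `(μ₁, α, τ², σ₁², σ₂²)` given `β`: constant `c` in the location
parameters, and `|β| p(Σ ∣ β)` in the variance parameters. -/
def priorParams (c ν₀ κ₀ ρ₀ β τ2 s1 s2 : ℝ) : ℝ :=
  c * (|β| * priorSigma ν₀ κ₀ ρ₀ β (covModel β τ2 s1 s2))

/-! ### Posterior -/

/-- Domain of `θ = (μ₁, α, τ², σ₁², σ₂²)`. -/
def paramDomain : Set (ℝ × ℝ × ℝ × ℝ × ℝ) :=
  {θ | 0 ≤ θ.2.2.1 ∧ 0 ≤ θ.2.2.2.1 ∧ 0 ≤ θ.2.2.2.2}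

/-- Sampling density times conditional prior density, as a function of
`θ = (μ₁, α, τ², σ₁², σ₂²)`. -/
def jointDensity {n : ℕ} (y₁ y₂ : Fin n → ℝ) (c ν₀ κ₀ ρ₀ β : ℝ)
    (θ : ℝ × ℝ × ℝ × ℝ × ℝ) : ℝ :=
  samplingDensity y₁ y₂ θ.1 θ.2.1 β θ.2.2.1 θ.2.2.2.1 θ.2.2.2.2 *
    priorParams c ν₀ κ₀ ρ₀ β θ.2.2.1 θ.2.2.2.1 θ.2.2.2.2

/-- Reduced sampling density `p(y ∣ β)`. -/
def reducedDensity {n : ℕ} (y₁ y₂ : Fin n → ℝ) (c ν₀ κ₀ ρ₀ β : ℝ) : ℝ :=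
  ∫ θ in paramDomain, jointDensity y₁ y₂ c ν₀ κ₀ ρ₀ β θ

/-- Marginal posterior density `p(β ∣ y)`, by Bayes' theorem. -/
def posterior {n : ℕ} (p : ℝ → ℝ) (y₁ y₂ : Fin n → ℝ) (c ν₀ κ₀ ρ₀ β : ℝ) : ℝ :=
  reducedDensity y₁ y₂ c ν₀ κ₀ ρ₀ β * p β / ∫ b, reducedDensity y₁ y₂ c ν₀ κ₀ ρ₀ b * p b

/-! ### The function `J` -/

/-- Student `t` probability density with `ν` degrees of freedom. -/
def tDensity (ν t : ℝ) : ℝ :=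
  Real.Gamma ((ν + 1) / 2) / (Real.sqrt (ν * Real.pi) * Real.Gamma (ν / 2)) *
    (1 + t ^ 2 / ν) ^ (-(ν + 1) / 2)

/-- Probability density of the `F` distribution with `d₁` and `d₂` degrees of freedom. -/
def fDensity (d₁ d₂ x : ℝ) : ℝ :=
  if 0 < x then
    Real.Gamma ((d₁ + d₂) / 2) / (Real.Gamma (d₁ / 2) * Real.Gamma (d₂ / 2)) *
      (d₁ / d₂) ^ (d₁ / 2) * x ^ (d₁ / 2 - 1) * (1 + d₁ / d₂ * x) ^ (-(d₁ + d₂) / 2)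
  else 0

/-- Cumulative distribution function of the `F` distribution. -/
def fCDF (d₁ d₂ x : ℝ) : ℝ := ∫ u in Set.Iic x, fDensity d₁ d₂ u

/-- Lower integration limit `t₋(ν, r)`. -/
def tMinus (ν r : ℝ) : ℝ := -Real.sqrt ν * r / Real.sqrt (1 - r ^ 2)

/-- Upper integration limit `t₊(b, ν, r)`. -/
def tPlus (b ν r : ℝ) : ℝ := Real.sqrt ν * (b - r) / Real.sqrt (1 - r ^ 2)

/-- The argument `F(t, b, ν, r)` of the `F` distribution function. -/
def fArg (t b ν r : ℝ) : ℝ :=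
  (ν - 1) / (ν + 1) *
    ((ν + t ^ 2) / ((tPlus b ν r - tMinus ν r) ^ 2 - (t - tMinus ν r) ^ 2))

/-- Integrand of `I(b, ν, r)`. -/
def integrandI (b ν r t : ℝ) : ℝ := tDensity ν t * fCDF (ν + 1) (ν - 1) (fArg t b ν r)

/-- The integral `I(b, ν, r)`. -/
def funI (b ν r : ℝ) : ℝ := ∫ t in (tMinus ν r)..(tPlus b ν r), integrandI b ν r t

/-- The function `J(β, ν, r, l)`. -/
def funJ (β ν r l : ℝ) : ℝ :=
  funI (|β| / l) ν (r * Real.sign β) + funI (l / |β|) ν (r * Real.sign β)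

/-- The density `p(β) J(β, ν, r, l) / ∫ p(b) J(b, ν, r, l) db`. -/
def limitDensity (p : ℝ → ℝ) (ν r l β : ℝ) : ℝ :=
  p β * funJ β ν r l / ∫ b, p b * funJ b ν r l

end EIV

end

noncomputable section

namespace EIV

open scoped ENNReal

/-! ### One-dimensional integrals -/

/-! Reduction to one truncated integral. For fixed Σ the flat location parameters integrate out as
two Gaussians, changing |Σ|^{-n/2} into |Σ|^{-(n-1)/2} and leaving an exponent that sees the data
only through S. The factor |β| in the prior is the Jacobian of (τ², σ₁², σ₂²) ↦ Σ, so by inverted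
Wishart conjugacy p(y | β) is, up to a constant, the quotient of two normalizing integrals
`kernelInt` over R_β: precision Ψ₀(β) + νS above, Ψ₀(β) below. Rescaling the second coordinate by β
(`kernelInt_scale`) turns R_β into the fixed region R₁ and Ψ₀(β) into ν₀M with M = κ₀²(1, ρ₀; ρ₀,
1). Hence the denominator is |β|^{-ν₀} times a β-free number, the power of |β| cancels, and the
β-free number drops out of the posterior (`posterior_eq`). What remains is the function `marginal`.

The limit. The dependence of the remaining integrand on ν₀ is a pointwise power A(Σ)^{ν₀}, where A =
|Σ|^{-1/2} exp(-tr(MΣ⁻¹)/2). This A is bounded, because tr(MΣ⁻¹) is at least a positive multiple of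
|Σ|^{-1/2} (`rpow_symDet_mul_exp_le`), so dominated convergence applies in Σ. To pass to the limit
also in the integral over β, one needs a bound uniform in β. `exists_kernelInt_one_le` bounds the
unit-slope integral by a multiple of |P|^{-m/2}, and in `marginal` at ν₀ = 0 this power exactly
offsets |β|^{-ν}. A proper prior for β is therefore enough.

Identification with J. Standardizing by the sample standard deviations and the sign of β turns the
limit into a truncated integral with slope b = |β|/l and precision (1, ρ; ρ, 1), ρ = r sign β. The
region is cut along Σ₂₂ = b²Σ₁₁; exchanging the two coordinates carries one piece to the other with
b replaced by 1/b, which accounts for the two terms of J (`kernelInt_eq_halfInt_add`). On a piece,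
use a = Σ₁₁, x = Σ₁₂/Σ₁₁ and the residual variance v. For fixed x the kernel is a product of inverse
gamma kernels in a and v, and the constraint bounds a/v, which produces the F distribution function.
The leftover power of a quadratic in x is a Student t density after an affine substitution
(`halfInt_eq`). The scale of S survives only in a β-free factor, so the normalized limit involves r
and l alone. -/

lemma lintegral_comp_mul_left (f : ℝ → ℝ≥0∞) {a : ℝ} (ha : a ≠ 0) :
    ENNReal.ofReal |a| * ∫⁻ x, f (a * x) = ∫⁻ x, f x := by
  have h : ∫⁻ x, f (a * x) = ENNReal.ofReal |a⁻¹| * ∫⁻ x, f x := by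
    have := lintegral_map_equiv (μ := volume) f (Homeomorph.mulLeft₀ a ha).toMeasurableEquiv
    simp only [Homeomorph.toMeasurableEquiv_coe, Homeomorph.coe_mulLeft₀] at this
    rw [← this, Real.map_volume_mul_left ha, lintegral_smul_measure, smul_eq_mul]
  rw [h, ← mul_assoc, ← ENNReal.ofReal_mul (abs_nonneg _), ← abs_mul, mul_inv_cancel₀ ha]
  simp

lemma lintegral_rpow_mul_exp_neg_mul {a r : ℝ} (ha : 0 < a) (hr : 0 < r) :
    ∫⁻ x in Set.Ioi 0, ENNReal.ofReal (x ^ (a - 1) * Real.exp (-(r * x))) =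
      ENNReal.ofReal (Real.Gamma a * r ^ (-a)) := by
  have hG := Real.Gamma_pos_of_pos ha
  have hra : 0 < r ^ a := Real.rpow_pos_of_pos hr a
  have h1 := ProbabilityTheory.lintegral_gammaPDF_eq_one ha hr
  have h2 : ∫⁻ x, ProbabilityTheory.gammaPDF a r x = ∫⁻ x in Set.Ioi 0,
      ENNReal.ofReal (r ^ a / Real.Gamma a) *
        ENNReal.ofReal (x ^ (a - 1) * Real.exp (-(r * x))) := by
    rw [← lintegral_add_compl _ (measurableSet_Ici (a := (0 : ℝ)))]
    have : ∫⁻ x in (Set.Ici (0 : ℝ))ᶜ, ProbabilityTheory.gammaPDF a r x = 0 :=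
      setLIntegral_eq_zero measurableSet_Ici.compl
        fun x hx => ProbabilityTheory.gammaPDF_of_neg (by simpa using hx)
    rw [this, add_zero, setLIntegral_congr Ioi_ae_eq_Ici.symm]
    refine setLIntegral_congr_fun measurableSet_Ioi fun x hx => ?_
    rw [ProbabilityTheory.gammaPDF_of_nonneg (le_of_lt hx), mul_assoc,
      ENNReal.ofReal_mul (by positivity)]
  rw [h2, lintegral_const_mul' _ _ ENNReal.ofReal_ne_top] at h1
  have h3 : ENNReal.ofReal (r ^ a / Real.Gamma a) *
      ENNReal.ofReal (Real.Gamma a * r ^ (-a)) = 1 := by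
    rw [← ENNReal.ofReal_mul (by positivity), Real.rpow_neg hr.le]
    field_simp
    simp
  have h4 : ENNReal.ofReal (r ^ a / Real.Gamma a) ≠ 0 := by
    simpa using div_pos hra hG
  exact (ENNReal.mul_right_inj h4 ENNReal.ofReal_ne_top).1 (h1.trans h3.symm)

/-- The substitution x ↦ 1/x turns the inverse gamma integral into a gamma integral. -/
lemma lintegral_rpow_mul_exp_neg_div {a r : ℝ} (ha : 0 < a) (hr : 0 < r) :
    ∫⁻ x in Set.Ioi 0, ENNReal.ofReal (x ^ (-a - 1) * Real.exp (-(r / x))) =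
      ENNReal.ofReal (Real.Gamma a * r ^ (-a)) := by
  rw [← lintegral_rpow_mul_exp_neg_mul ha hr]
  have him : (fun x : ℝ => x⁻¹) '' Set.Ioi 0 = Set.Ioi 0 := by
    ext x
    simp only [Set.mem_image, Set.mem_Ioi]
    exact ⟨fun ⟨y, hy, h⟩ => h ▸ inv_pos.2 hy, fun h => ⟨x⁻¹, inv_pos.2 h, inv_inv x⟩⟩
  have := lintegral_image_eq_lintegral_abs_deriv_mul (measurableSet_Ioi (a := (0 : ℝ)))
    (fun x hx => (hasDerivAt_inv (ne_of_gt hx)).hasDerivWithinAt)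
    (inv_injective.injOn) (fun x => ENNReal.ofReal (x ^ (a - 1) * Real.exp (-(r * x))))
  rw [him] at this
  rw [this]
  refine setLIntegral_congr_fun measurableSet_Ioi fun x hx => ?_
  have hx : 0 < x := hx
  rw [← ENNReal.ofReal_mul (abs_nonneg _), ← mul_assoc, div_eq_mul_inv]
  congr 2
  rw [abs_neg, abs_of_pos (by positivity), Real.inv_rpow hx.le, ← Real.rpow_neg hx.le,
    ← Real.rpow_natCast, ← Real.rpow_neg hx.le, ← Real.rpow_add hx]
  congr 1
  push_cast
  ring

lemma lintegral_exp_neg_mul_sub_sq {b : ℝ} (hb : 0 < b) (e : ℝ) :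
    ∫⁻ x, ENNReal.ofReal (Real.exp (-b * (x - e) ^ 2)) =
      ENNReal.ofReal (Real.sqrt (Real.pi / b)) := by
  rw [lintegral_sub_right_eq_self (fun x => ENNReal.ofReal (Real.exp (-b * x ^ 2))),
    ← integral_gaussian, ofReal_integral_eq_lintegral_ofReal (integrable_exp_neg_mul_sq hb)
      (ae_of_all _ fun x => (Real.exp_pos _).le)]

/-- This is the Beta(1/2, 1/2) normalization. It controls the endpoint singularities in x = Σ₁₂/Σ₁₁
when the kernel is bounded over the unit-slope region. -/
lemma lintegral_inv_sqrt_mul_one_sub_lt_top :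
    ∫⁻ x in Set.Ioo (0 : ℝ) 1, ENNReal.ofReal ((x * (1 - x)) ^ (-(1 / 2) : ℝ)) < ∞ := by
  have hB : 0 < ProbabilityTheory.beta (1 / 2) (1 / 2) :=
    ProbabilityTheory.beta_pos (by norm_num) (by norm_num)
  have h1 := ProbabilityTheory.lintegral_betaPDF_eq_one (α := 1 / 2) (β := 1 / 2)
    (by norm_num) (by norm_num)
  rw [ProbabilityTheory.lintegral_betaPDF] at h1
  have h2 : ∫⁻ x in Set.Ioo (0 : ℝ) 1, ENNReal.ofReal ((x * (1 - x)) ^ (-(1 / 2) : ℝ)) =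
      ENNReal.ofReal (ProbabilityTheory.beta (1 / 2) (1 / 2)) *
      ∫⁻ x in Set.Ioo (0 : ℝ) 1, ENNReal.ofReal (1 / ProbabilityTheory.beta (1 / 2) (1 / 2) *
        x ^ ((1 : ℝ) / 2 - 1) * (1 - x) ^ ((1 : ℝ) / 2 - 1)) := by
    rw [← lintegral_const_mul' _ _ ENNReal.ofReal_ne_top]
    refine setLIntegral_congr_fun measurableSet_Ioo fun x hx => ?_
    rw [← ENNReal.ofReal_mul hB.le, Real.mul_rpow hx.1.le (by linarith [hx.2])]
    congr 1
    norm_num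
    field_simp
  rw [h2, h1, mul_one]
  exact ENNReal.ofReal_lt_top

/-! ### The inverted Wishart kernel in coordinates -/

/-- Determinant of `symMat s`. -/
def symDet (s : ℝ × ℝ × ℝ) : ℝ := s.1 * s.2.2 - s.2.1 ^ 2

/-- The kernel `|Σ|^{-(m+3)/2} exp (-tr(P Σ⁻¹)/2)` for `Σ = symMat s` and precision `symMat P`. -/
def kernel (m : ℝ) (P s : ℝ × ℝ × ℝ) : ℝ :=
  symDet s ^ (-(m + 3) / 2) *
    Real.exp (-(1 / 2) * ((P.1 * s.2.2 - 2 * P.2.1 * s.2.1 + P.2.2 * s.1) / symDet s))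

/-- The region for the slope `β` in coordinates. -/
def regionSet (β : ℝ) : Set (ℝ × ℝ × ℝ) :=
  {s | 0 < s.1 ∧ 0 < symDet s ∧ 0 ≤ s.2.1 / β ∧ s.2.1 / β ≤ s.1 ∧ β * s.2.1 ≤ s.2.2}

lemma posDef_symMat_iff (s : ℝ × ℝ × ℝ) : (symMat s).PosDef ↔ 0 < s.1 ∧ 0 < symDet s := by
  constructor
  · intro h
    refine ⟨by simpa [symMat] using h.diag_pos (i := 0), ?_⟩
    have := h.det_pos
    rw [symMat, Matrix.det_fin_two_of] at this
    rw [symDet]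
    linarith
  · rintro ⟨h1, h2⟩
    refine Matrix.PosDef.of_dotProduct_mulVec_pos ?_ fun x hx => ?_
    · ext i j
      fin_cases i <;> fin_cases j <;> simp [symMat]
    · simp only [symMat, dotProduct, Matrix.mulVec, Fin.sum_univ_two, Pi.star_apply, star_trivial,
        Matrix.of_apply, Matrix.cons_val', Matrix.cons_val_zero, Matrix.cons_val_one,
        Matrix.cons_val_fin_one]
      rw [symDet] at h2
      have key : s.1 * (x 0 * (s.1 * x 0 + s.2.1 * x 1) + x 1 * (s.2.1 * x 0 + s.2.2 * x 1)) =
          (s.1 * x 0 + s.2.1 * x 1) ^ 2 + (s.1 * s.2.2 - s.2.1 ^ 2) * x 1 ^ 2 := by ring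
      refine pos_of_mul_pos_right (a := s.1) ?_ h1.le
      rw [key]
      by_cases hx1 : x 1 = 0
      · have hx0 : x 0 ≠ 0 := by
          intro h0
          apply hx
          ext i
          fin_cases i <;> simp [h0, hx1]
        rw [hx1]
        have : 0 < (s.1 * x 0) ^ 2 := by positivity
        simpa using this
      · positivity

lemma symMat_mem_region_iff (β : ℝ) (s : ℝ × ℝ × ℝ) : symMat s ∈ region β ↔ s ∈ regionSet β := by
  simp only [region, regionSet, Set.mem_ofPred_eq, posDef_symMat_iff]
  simp only [symMat, Matrix.of_apply, Matrix.cons_val', Matrix.cons_val_zero, Matrix.cons_val_one,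
        Matrix.cons_val_fin_one, one_div_mul_eq_div, sub_nonneg, and_assoc]

lemma iwKernel_symMat (m : ℝ) (P s : ℝ × ℝ × ℝ) :
    iwKernel m (symMat P) (symMat s) = kernel m P s := by
  have hd : (symMat s).det = symDet s := by
    rw [symMat, Matrix.det_fin_two_of, symDet]; ring
  rw [iwKernel, kernel, hd, Matrix.inv_def, hd]
  congr 3
  simp only [symMat, Matrix.adjugate_fin_two_of, Matrix.trace_fin_two, Matrix.mul_apply,
    Fin.sum_univ_two, Matrix.smul_apply, Matrix.of_apply, Matrix.cons_val', Matrix.cons_val_zero,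
    Matrix.cons_val_one, Matrix.cons_val_fin_one, smul_eq_mul, Ring.inverse_eq_inv']
  ring

lemma precision_eq_symMat (ν₀ κ₀ ρ₀ β : ℝ) : precision ν₀ κ₀ ρ₀ β =
    symMat (ν₀ * κ₀ ^ 2, ν₀ * κ₀ ^ 2 * (ρ₀ * β), ν₀ * κ₀ ^ 2 * β ^ 2) := by
  simp [precision, symMat]

@[fun_prop]
lemma measurable_symDet : Measurable symDet := by unfold symDet; fun_prop

@[fun_prop]
lemma measurable_kernel (m : ℝ) (P : ℝ × ℝ × ℝ) : Measurable (kernel m P) := by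
  unfold kernel; fun_prop

@[measurability]
lemma measurableSet_regionSet (β : ℝ) : MeasurableSet (regionSet β) := by
  unfold regionSet
  simp only [Set.ofPred_and]
  exact (measurableSet_lt (f := fun _ : ℝ × ℝ × ℝ => (0 : ℝ)) (by fun_prop) (by fun_prop)).inter <|
    (measurableSet_lt (f := fun _ : ℝ × ℝ × ℝ => (0 : ℝ)) (by fun_prop) (by fun_prop)).inter <|
    (measurableSet_le (f := fun _ : ℝ × ℝ × ℝ => (0 : ℝ)) (g := fun s => s.2.1 / β)
      (by fun_prop) (by fun_prop)).inter <|
    (measurableSet_le (f := fun s : ℝ × ℝ × ℝ => s.2.1 / β) (g := fun s => s.1)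
      (by fun_prop) (by fun_prop)).inter
    (measurableSet_le (f := fun s : ℝ × ℝ × ℝ => β * s.2.1) (g := fun s => s.2.2)
      (by fun_prop) (by fun_prop))

lemma kernel_nonneg {m : ℝ} {P s : ℝ × ℝ × ℝ} (hs : 0 < symDet s) : 0 ≤ kernel m P s := by
  unfold kernel; positivity

lemma kernel_pos {m : ℝ} {P s : ℝ × ℝ × ℝ} (hs : 0 < symDet s) : 0 < kernel m P s := by
  unfold kernel; positivity

/-- The kernel restricted to the region. -/
def kernelOn (β m : ℝ) (P : ℝ × ℝ × ℝ) : ℝ × ℝ × ℝ → ℝ≥0∞ :=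
  (regionSet β).indicator fun s => ENNReal.ofReal (kernel m P s)

/-- The normalization factor as an extended nonnegative number. -/
def kernelInt (β m : ℝ) (P : ℝ × ℝ × ℝ) : ℝ≥0∞ := ∫⁻ s, kernelOn β m P s

lemma measurable_kernelOn (β m : ℝ) (P : ℝ × ℝ × ℝ) : Measurable (kernelOn β m P) :=
  (measurable_kernel m P).ennreal_ofReal.indicator (measurableSet_regionSet β)

lemma kernelInt_eq_setLIntegral (β m : ℝ) (P : ℝ × ℝ × ℝ) :
    kernelInt β m P = ∫⁻ s in regionSet β, ENNReal.ofReal (kernel m P s) :=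
  lintegral_indicator (measurableSet_regionSet β) _

lemma lintegral_triple {f : ℝ × ℝ × ℝ → ℝ≥0∞} (hf : Measurable f) :
    ∫⁻ s, f s = ∫⁻ a, ∫⁻ h, ∫⁻ d, f (a, h, d) := by
  rw [Measure.volume_eq_prod, lintegral_prod _ hf.aemeasurable]
  refine lintegral_congr fun a => ?_
  rw [Measure.volume_eq_prod, lintegral_prod _ (by fun_prop)]

/-- Substitute Σ = DΣ'D with D = diag(p, q). The Jacobian |pq|³ meets |pq|^{-(m+3)} from the
determinant, the trace absorbs D into the precision, and the inequalities defining the region keep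
their form with a new slope. Negative p or q is allowed, which later serves to make the slope
positive. -/
lemma kernelInt_scale (β m : ℝ) (P : ℝ × ℝ × ℝ) {p q : ℝ} (hp : p ≠ 0) (hq : q ≠ 0) :
    kernelInt β m P = ENNReal.ofReal (|p * q| ^ (-m)) *
      kernelInt (p * β / q) m (P.1 / p ^ 2, P.2.1 / (p * q), P.2.2 / q ^ 2) := by
  have hpq : 0 < |p * q| := abs_pos.2 (mul_ne_zero hp hq)
  have h1 : ∀ s : ℝ × ℝ × ℝ, kernelOn β m P (p ^ 2 * s.1, p * q * s.2.1, q ^ 2 * s.2.2) =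
      ENNReal.ofReal (|p * q| ^ (-(m + 3))) *
        kernelOn (p * β / q) m (P.1 / p ^ 2, P.2.1 / (p * q), P.2.2 / q ^ 2) s := by
    intro s
    have hdet : symDet (p ^ 2 * s.1, p * q * s.2.1, q ^ 2 * s.2.2) =
        |p * q| ^ 2 * symDet s := by
      rw [sq_abs]; simp only [symDet]; ring
    have hmem : (p ^ 2 * s.1, p * q * s.2.1, q ^ 2 * s.2.2) ∈ regionSet β ↔
        s ∈ regionSet (p * β / q) := by
      simp only [regionSet, Set.mem_ofPred_eq, hdet]
      have e1 : p * q * s.2.1 / β = p ^ 2 * (s.2.1 / (p * β / q)) := by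
        by_cases hβ : β = 0
        · simp [hβ]
        · field_simp
      have e2 : β * (p * q * s.2.1) = q ^ 2 * (p * β / q * s.2.1) := by field_simp
      have hp2 : 0 < p ^ 2 := by positivity
      have hq2 : 0 < q ^ 2 := by positivity
      have hpq2 : 0 < |p * q| ^ 2 := by positivity
      rw [e1, e2, mul_pos_iff_of_pos_left hp2, mul_pos_iff_of_pos_left hpq2,
        mul_nonneg_iff_of_pos_left hp2, mul_le_mul_iff_right₀ hp2, mul_le_mul_iff_right₀ hq2]
    unfold kernelOn
    by_cases hs : s ∈ regionSet (p * β / q)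
    · rw [Set.indicator_of_mem hs, Set.indicator_of_mem (hmem.2 hs),
        ← ENNReal.ofReal_mul (by positivity)]
      congr 1
      have hd : 0 < symDet s := hs.2.1
      simp only [kernel, hdet]
      rw [Real.mul_rpow (by positivity) hd.le, ← Real.rpow_natCast, ← Real.rpow_mul hpq.le,
        mul_assoc]
      congr 2
      · push_cast; ring_nf
      · congr 2
        rw [Real.rpow_natCast, sq_abs]
        field_simp
    · rw [Set.indicator_of_notMem hs, Set.indicator_of_notMem (fun h => hs (hmem.1 h)), mul_zero]
  have hm := measurable_kernelOn β m P
  unfold kernelInt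
  have hp2 : p ^ 2 ≠ 0 := by positivity
  have hq2 : q ^ 2 ≠ 0 := by positivity
  have hpq' : p * q ≠ 0 := mul_ne_zero hp hq
  calc ∫⁻ s, kernelOn β m P s = ∫⁻ a, ∫⁻ h, ∫⁻ d, kernelOn β m P (a, h, d) := lintegral_triple hm
    _ = ∫⁻ a, ∫⁻ h, ENNReal.ofReal |q ^ 2| * ∫⁻ d, kernelOn β m P (a, h, q ^ 2 * d) := by
      refine lintegral_congr fun a => lintegral_congr fun h => ?_
      rw [lintegral_comp_mul_left (fun d => kernelOn β m P (a, h, d)) hq2]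
    _ = ∫⁻ a, ENNReal.ofReal |p * q| * ∫⁻ h, ENNReal.ofReal |q ^ 2| *
          ∫⁻ d, kernelOn β m P (a, p * q * h, q ^ 2 * d) := by
      refine lintegral_congr fun a => ?_
      rw [lintegral_comp_mul_left (fun h => ENNReal.ofReal |q ^ 2| *
          ∫⁻ d, kernelOn β m P (a, h, q ^ 2 * d)) hpq']
    _ = ENNReal.ofReal |p ^ 2| * ∫⁻ a, ENNReal.ofReal |p * q| * ∫⁻ h, ENNReal.ofReal |q ^ 2| *
          ∫⁻ d, kernelOn β m P (p ^ 2 * a, p * q * h, q ^ 2 * d) := by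
      rw [lintegral_comp_mul_left (fun a => ENNReal.ofReal |p * q| * ∫⁻ h, ENNReal.ofReal |q ^ 2| *
          ∫⁻ d, kernelOn β m P (a, p * q * h, q ^ 2 * d)) hp2]
    _ = ENNReal.ofReal |p ^ 2| * (ENNReal.ofReal |p * q| * (ENNReal.ofReal |q ^ 2| *
          ∫⁻ s : ℝ × ℝ × ℝ, kernelOn β m P (p ^ 2 * s.1, p * q * s.2.1, q ^ 2 * s.2.2))) := by
      simp_rw [lintegral_const_mul' _ _ ENNReal.ofReal_ne_top]
      rw [lintegral_triple (by fun_prop)]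
    _ = _ := by
      simp_rw [h1, lintegral_const_mul' _ _ ENNReal.ofReal_ne_top, ← mul_assoc]
      congr 1
      rw [← ENNReal.ofReal_mul (by positivity), ← ENNReal.ofReal_mul (by positivity),
        ← ENNReal.ofReal_mul (by positivity)]
      congr 1
      have : |p ^ 2| * |p * q| * |q ^ 2| = |p * q| ^ (3 : ℝ) := by
        rw [← abs_mul, ← abs_mul, show (3 : ℝ) = ((3 : ℕ) : ℝ) by norm_num, Real.rpow_natCast,
          ← abs_pow]
        congr 1; ring
      rw [this, ← Real.rpow_add hpq]
      congr 1; ring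

/-! ### Regression coordinates `Σ₁₁ = a`, `Σ₁₂ = a x`, `Σ₂₂ = v + x² a` -/

/-- Here x is the regression slope of the second coordinate on the first and v the residual
variance. For fixed a the map is a dilation in Σ₁₂, with Jacobian a, followed by a translation in
Σ₂₂. -/
lemma lintegral_regression_coords {f : ℝ × ℝ × ℝ → ℝ≥0∞} (hf : Measurable f)
    (h0 : ∀ s, s.1 ≤ 0 → f s = 0) :
    ∫⁻ s, f s = ∫⁻ x, ∫⁻ a in Set.Ioi 0, ∫⁻ v,
      ENNReal.ofReal a * f (a, a * x, v + x ^ 2 * a) := by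
  calc ∫⁻ s, f s = ∫⁻ a, ∫⁻ h, ∫⁻ d, f (a, h, d) := lintegral_triple hf
    _ = ∫⁻ a in Set.Ioi 0, ∫⁻ h, ∫⁻ d, f (a, h, d) := by
      rw [← lintegral_indicator measurableSet_Ioi]
      refine lintegral_congr fun a => ?_
      by_cases ha : a ∈ Set.Ioi (0 : ℝ)
      · rw [Set.indicator_of_mem ha]
      · rw [Set.indicator_of_notMem ha]
        have : ∀ h d, f (a, h, d) = 0 := fun h d => h0 _ (by simpa using ha)
        simp [this]
    _ = ∫⁻ a in Set.Ioi 0, ∫⁻ x, ∫⁻ v, ENNReal.ofReal a * f (a, a * x, v + x ^ 2 * a) := by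
      refine setLIntegral_congr_fun measurableSet_Ioi fun a ha => ?_
      have ha : 0 < a := ha
      rw [← lintegral_comp_mul_left (fun h => ∫⁻ d, f (a, h, d)) ha.ne', abs_of_pos ha,
        ← lintegral_const_mul' _ _ ENNReal.ofReal_ne_top]
      refine lintegral_congr fun x => ?_
      rw [lintegral_const_mul' _ _ ENNReal.ofReal_ne_top,
        lintegral_add_right_eq_self (fun d => f (a, a * x, d))]
    _ = _ := by
      rw [lintegral_lintegral_swap]
      refine Measurable.aemeasurable ?_
      simp only [Function.uncurry_def]
      refine Measurable.lintegral_prod_right' (f := fun z : (ℝ × ℝ) × ℝ =>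
        ENNReal.ofReal z.1.1 * f (z.1.1, z.1.1 * z.1.2, z.2 + z.1.2 ^ 2 * z.1.1)) ?_
      fun_prop

lemma symDet_regression (a x v : ℝ) : symDet (a, a * x, v + x ^ 2 * a) = a * v := by
  simp only [symDet]; ring

/-- In regression coordinates |Σ| = av and the trace separates into a term in 1/a and a term in 1/v.
For fixed x the kernel thus factors into two inverse gamma kernels, and x enters only the rate of
the second. -/
lemma mul_kernel_regression (m : ℝ) (P : ℝ × ℝ × ℝ) {a v : ℝ} (x : ℝ) (ha : 0 < a) (hv : 0 < v) :
    a * kernel m P (a, a * x, v + x ^ 2 * a) =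
      a ^ (-(m + 1) / 2) * v ^ (-(m + 3) / 2) * (Real.exp (-(P.1 / 2 / a)) *
        Real.exp (-((P.1 * x ^ 2 - 2 * P.2.1 * x + P.2.2) / 2 / v))) := by
  rw [kernel, symDet_regression, Real.mul_rpow ha.le hv.le, ← Real.exp_add]
  have h1 : a ^ (-(m + 1) / 2) = a * a ^ (-(m + 3) / 2) := by
    conv_rhs => rw [← Real.rpow_one a, ← Real.rpow_mul ha.le, one_mul, ← Real.rpow_add ha]
    congr 1; ring
  have h2 : -(1 / 2) * ((P.1 * (v + x ^ 2 * a) - 2 * P.2.1 * (a * x) + P.2.2 * a) / (a * v)) =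
      -(P.1 / 2 / a) + -((P.1 * x ^ 2 - 2 * P.2.1 * x + P.2.2) / 2 / v) := by
    field_simp
    ring
  rw [h1, h2]
  ring

/-- On the region the kernel is dominated by a product of inverse gamma densities. -/
lemma kernelOn_one_regression_le {m : ℝ} {P : ℝ × ℝ × ℝ} (hP : 0 < P.1) {a x : ℝ} (ha : 0 < a)
    (hx : x ∈ Set.Ioo (0 : ℝ) 1) (v : ℝ) :
    ENNReal.ofReal a * kernelOn 1 m P (a, a * x, v + x ^ 2 * a) ≤
      (ENNReal.ofReal ((x * (1 - x)) ^ (-(1 / 2) : ℝ)) *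
        ENNReal.ofReal (a ^ (-(m / 2) - 1) * Real.exp (-(P.1 / 2 / a)))) *
        (Set.Ioi 0).indicator (fun v => ENNReal.ofReal (v ^ (-(m / 2) - 1) *
          Real.exp (-(symDet P / P.1 / 2 / v)))) v := by
  have hx0 := hx.1
  have hx1 : 0 < 1 - x := by linarith [hx.2]
  unfold kernelOn
  by_cases hs : (a, a * x, v + x ^ 2 * a) ∈ regionSet 1
  swap
  · rw [Set.indicator_of_notMem hs]; simp
  have hv : 0 < v := by
    have := hs.2.1
    rw [symDet_regression] at this
    exact pos_of_mul_pos_right this ha.le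
  have hle : x * (1 - x) * a ≤ v := by
    have := hs.2.2.2.2
    simp only [one_mul] at this
    linarith
  rw [Set.indicator_of_mem hs, Set.indicator_of_mem (Set.mem_Ioi.2 hv), ← ENNReal.ofReal_mul ha.le,
    mul_kernel_regression m P x ha hv, ← ENNReal.ofReal_mul (by positivity),
    ← ENNReal.ofReal_mul (by positivity)]
  refine ENNReal.ofReal_le_ofReal ?_
  -- The quadratic in x attains its minimum |P|/P₁₁ at x = P₁₂/P₁₁.
  have hq : symDet P / P.1 ≤ P.1 * x ^ 2 - 2 * P.2.1 * x + P.2.2 := by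
    rw [div_le_iff₀ hP, symDet]
    nlinarith [sq_nonneg (P.1 * x - P.2.1)]
  have he : Real.exp (-((P.1 * x ^ 2 - 2 * P.2.1 * x + P.2.2) / 2 / v)) ≤
      Real.exp (-(symDet P / P.1 / 2 / v)) := by
    gcongr
  -- The power of a alone would be integrable at infinity only for m > 1. Moving a factor
  -- (v/a)^{-1/2} out gives both variables shape m/2, and the constraint v ≥ x(1 - x)a bounds that
  -- factor, so every m > 0 is covered.
  have e1 : a ^ (-(m + 1) / 2) * v ^ (-(m + 3) / 2) =
      a ^ (-(m / 2) - 1) * v ^ (-(m / 2) - 1) * (v / a) ^ (-(1 / 2) : ℝ) := by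
    rw [Real.div_rpow hv.le ha.le, div_eq_mul_inv (v ^ (-(1 / 2) : ℝ)), ← Real.rpow_neg ha.le]
    calc _ = a ^ (-(m / 2) - 1 + - -(1 / 2)) * v ^ (-(m / 2) - 1 + -(1 / 2)) := by
          congr 2 <;> ring
      _ = _ := by rw [Real.rpow_add ha, Real.rpow_add hv]; ring
  have e2 : (v / a) ^ (-(1 / 2) : ℝ) ≤ (x * (1 - x)) ^ (-(1 / 2) : ℝ) :=
    Real.rpow_le_rpow_of_nonpos (by positivity) ((le_div_iff₀ ha).2 hle) (by norm_num)
  rw [e1]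
  calc _ ≤ a ^ (-(m / 2) - 1) * v ^ (-(m / 2) - 1) * (x * (1 - x)) ^ (-(1 / 2) : ℝ) *
        (Real.exp (-(P.1 / 2 / a)) * Real.exp (-(symDet P / P.1 / 2 / v))) := by gcongr
    _ = _ := by ring

/-- The two inverse gamma integrals contribute (P₁₁/2)^{-m/2} and (|P|/(2P₁₁))^{-m/2}. Their product
no longer contains P₁₁, so the bound depends on P through its determinant only; this is what later
makes the bound uniform in the slope. -/
lemma exists_kernelInt_one_le {m : ℝ} (hm : 0 < m) : ∃ C : ℝ, ∀ P : ℝ × ℝ × ℝ,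
    0 < P.1 → 0 < symDet P → kernelInt 1 m P ≤ ENNReal.ofReal (C * symDet P ^ (-(m / 2))) := by
  set B := ∫⁻ x in Set.Ioo (0 : ℝ) 1, ENNReal.ofReal ((x * (1 - x)) ^ (-(1 / 2) : ℝ)) with hB
  have hBt : B ≠ ∞ := lintegral_inv_sqrt_mul_one_sub_lt_top.ne
  have hm2 : 0 < m / 2 := by positivity
  have hG := Real.Gamma_pos_of_pos hm2
  refine ⟨B.toReal * (Real.Gamma (m / 2) ^ 2 * (1 / 4) ^ (-(m / 2))), fun P hP hD => ?_⟩
  have hI : 0 < symDet P / P.1 / 2 := by positivity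
  have hI' : 0 < P.1 / 2 := by positivity
  calc kernelInt 1 m P = ∫⁻ x, ∫⁻ a in Set.Ioi 0, ∫⁻ v,
        ENNReal.ofReal a * kernelOn 1 m P (a, a * x, v + x ^ 2 * a) := by
        refine lintegral_regression_coords (measurable_kernelOn _ _ _) fun s hs => ?_
        exact Set.indicator_of_notMem (fun h => absurd h.1 hs.not_gt) _
    _ = ∫⁻ x in Set.Ioo 0 1, ∫⁻ a in Set.Ioi 0, ∫⁻ v,
        ENNReal.ofReal a * kernelOn 1 m P (a, a * x, v + x ^ 2 * a) := by
        -- The region forces 0 ≤ x ≤ 1. The endpoints are discarded as a null set because the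
        -- dominating power needs x(1 - x) > 0.
        rw [setLIntegral_congr Ioo_ae_eq_Icc, ← lintegral_indicator measurableSet_Icc]
        refine lintegral_congr fun x => ?_
        by_cases hx : x ∈ Set.Icc (0 : ℝ) 1
        · rw [Set.indicator_of_mem hx]
        · rw [Set.indicator_of_notMem hx, setLIntegral_eq_zero measurableSet_Ioi]
          intro a ha
          have ha : 0 < a := ha
          simp only [Pi.zero_apply]
          refine lintegral_eq_zero_of_ae_eq_zero (ae_of_all _ fun v => ?_)
          have : (a, a * x, v + x ^ 2 * a) ∉ regionSet 1 := by
            intro h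
            apply hx
            have h1 := h.2.2.1
            have h2 := h.2.2.2.1
            simp only [div_one] at h1 h2
            exact ⟨by rwa [mul_nonneg_iff_of_pos_left ha] at h1,
              le_of_mul_le_mul_left (by linarith) ha⟩
          simp [kernelOn, Set.indicator_of_notMem this]
    _ ≤ ∫⁻ x in Set.Ioo 0 1, ∫⁻ a in Set.Ioi 0, ∫⁻ v,
        (ENNReal.ofReal ((x * (1 - x)) ^ (-(1 / 2) : ℝ)) *
        ENNReal.ofReal (a ^ (-(m / 2) - 1) * Real.exp (-(P.1 / 2 / a)))) *
        (Set.Ioi 0).indicator (fun v => ENNReal.ofReal (v ^ (-(m / 2) - 1) *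
          Real.exp (-(symDet P / P.1 / 2 / v)))) v := by
        refine setLIntegral_mono' measurableSet_Ioo fun x hx =>
          setLIntegral_mono' measurableSet_Ioi fun a ha => lintegral_mono fun v => ?_
        exact kernelOn_one_regression_le hP ha hx v
    _ = ∫⁻ x in Set.Ioo 0 1, ENNReal.ofReal ((x * (1 - x)) ^ (-(1 / 2) : ℝ)) *
        (ENNReal.ofReal (Real.Gamma (m / 2) * (P.1 / 2) ^ (-(m / 2))) *
         ENNReal.ofReal (Real.Gamma (m / 2) * (symDet P / P.1 / 2) ^ (-(m / 2)))) := by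
        refine lintegral_congr fun x => ?_
        rw [← lintegral_rpow_mul_exp_neg_div hm2 hI', ← lintegral_rpow_mul_exp_neg_div hm2 hI,
          ← lintegral_indicator (measurableSet_Ioi (a := (0 : ℝ)))
            (fun v => ENNReal.ofReal (v ^ (-(m / 2) - 1) * Real.exp (-(symDet P / P.1 / 2 / v)))),
          ← lintegral_mul_const _ (by fun_prop),
          ← lintegral_const_mul' _ _ ENNReal.ofReal_ne_top]
        refine lintegral_congr fun a => ?_
        rw [lintegral_const_mul' _ _ (ENNReal.mul_ne_top ENNReal.ofReal_ne_top
          ENNReal.ofReal_ne_top), mul_assoc]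
    _ = _ := by
        rw [lintegral_mul_const _ (by fun_prop), ← hB, ← ENNReal.ofReal_mul (by positivity),
          mul_assoc B.toReal, ENNReal.ofReal_mul ENNReal.toReal_nonneg, ENNReal.ofReal_toReal hBt]
        congr 2
        have : (P.1 / 2) ^ (-(m / 2)) * (symDet P / P.1 / 2) ^ (-(m / 2)) =
            (1 / 4) ^ (-(m / 2)) * symDet P ^ (-(m / 2)) := by
          rw [← Real.mul_rpow hI'.le hI.le, ← Real.mul_rpow (by norm_num) hD.le]
          congr 1
          field_simp
          norm_num
        linear_combination (Real.Gamma (m / 2)) ^ 2 * this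

lemma kernelInt_one_lt_top {m : ℝ} (hm : 0 < m) {P : ℝ × ℝ × ℝ} (hP : 0 < P.1)
    (hD : 0 < symDet P) : kernelInt 1 m P < ∞ := by
  obtain ⟨C, hC⟩ := exists_kernelInt_one_le hm
  exact (hC P hP hD).trans_lt ENNReal.ofReal_lt_top

lemma kernelInt_pos {m : ℝ} (P : ℝ × ℝ × ℝ) : 0 < kernelInt 1 m P := by
  rw [kernelInt_eq_setLIntegral, setLIntegral_pos_iff (measurable_kernel m P).ennreal_ofReal]
  -- On this box the determinant exceeds 2·2 - 1 and the off-diagonal entry lies below both diagonal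
  -- entries, so it is a piece of the region with positive volume.
  have hsub : Set.Ioo (2 : ℝ) 3 ×ˢ (Set.Ioo (0 : ℝ) 1 ×ˢ Set.Ioo (2 : ℝ) 3) ⊆
      (Function.support fun s => ENNReal.ofReal (kernel m P s)) ∩ regionSet 1 := by
    rintro ⟨a, h, d⟩ ⟨ha, hh, hd⟩
    simp only [Set.mem_Ioo] at ha hh hd
    have hdet : 0 < symDet (a, h, d) := by
      simp only [symDet]; nlinarith
    refine ⟨?_, ?_⟩
    · rw [Function.mem_support]
      exact (ENNReal.ofReal_pos.2 (kernel_pos hdet)).ne'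
    · refine ⟨?_, hdet, ?_, ?_, ?_⟩ <;> simp only [div_one] <;> linarith
  refine lt_of_lt_of_le ?_ (measure_mono hsub)
  have : (volume : Measure (ℝ × ℝ × ℝ))
      (Set.Ioo (2 : ℝ) 3 ×ˢ (Set.Ioo (0 : ℝ) 1 ×ˢ Set.Ioo (2 : ℝ) 3)) = 1 := by
    rw [Measure.volume_eq_prod, Measure.prod_prod, Measure.volume_eq_prod, Measure.prod_prod]
    simp only [Real.volume_Ioo]
    norm_num
  rw [this]; exact one_pos

/-! ### The `F` distribution -/

lemma fDensity_nonneg {d₁ d₂ : ℝ} (h₁ : 0 < d₁) (h₂ : 0 < d₂) (x : ℝ) : 0 ≤ fDensity d₁ d₂ x := by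
  have := Real.Gamma_pos_of_pos (half_pos h₁)
  have := Real.Gamma_pos_of_pos (half_pos h₂)
  have := Real.Gamma_pos_of_pos (half_pos (add_pos h₁ h₂))
  unfold fDensity
  split_ifs <;> positivity

@[fun_prop]
lemma measurable_fDensity (d₁ d₂ : ℝ) : Measurable (fDensity d₁ d₂) :=
  Measurable.ite measurableSet_Ioi (by fun_prop) measurable_const

/-- Product of two inverse gamma kernels with rates `1/2` and `q/2`. -/
def invGammaProd (ν q a v : ℝ) : ℝ :=
  a ^ (-(ν + 1) / 2) * v ^ (-(ν + 3) / 2) * (Real.exp (-(1 / 2 / a)) * Real.exp (-(q / 2 / v)))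

lemma mul_invGammaProd {ν q y v : ℝ} (hy : 0 < y) (hv : 0 < v) :
    v * invGammaProd ν q (v * y) v = y ^ (-(ν + 1) / 2) *
      (v ^ (-ν - 1) * Real.exp (-((1 / y + q) / 2 / v))) := by
  rw [invGammaProd, Real.mul_rpow hv.le hy.le, ← Real.exp_add]
  have h1 : v ^ (-ν - 1) = v * v ^ (-(ν + 1) / 2) * v ^ (-(ν + 3) / 2) := by
    conv_rhs => rw [← Real.rpow_one v, ← Real.rpow_mul hv.le, ← Real.rpow_mul hv.le, one_mul,
      one_mul, ← Real.rpow_add hv, ← Real.rpow_add hv]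
    congr 1; ring
  have h2 : -(1 / 2 / (v * y)) + -(q / 2 / v) = -((1 / y + q) / 2 / v) := by
    field_simp
    ring
  rw [h1, h2]
  ring

/-- With the ratio y = a/v held fixed, the two exponentials merge into one inverse gamma kernel in v
of shape ν and rate (1/y + q)/2. What is left is an unnormalized F density in a rescaled y. -/
lemma lintegral_mul_invGammaProd {ν q y : ℝ} (hν : 1 < ν) (hq : 0 < q) (hy : 0 < y) :
    ∫⁻ v in Set.Ioi 0, ENNReal.ofReal (v * invGammaProd ν q (v * y) v) =
      ENNReal.ofReal (2 ^ ν * Real.Gamma ν * (y ^ ((ν - 1) / 2) * (1 + q * y) ^ (-ν))) := by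
  have hr : 0 < (1 / y + q) / 2 := by positivity
  have hν0 : 0 < ν := by linarith
  calc _ = ∫⁻ v in Set.Ioi 0, ENNReal.ofReal (y ^ (-(ν + 1) / 2)) *
        ENNReal.ofReal (v ^ (-ν - 1) * Real.exp (-((1 / y + q) / 2 / v))) := by
        refine setLIntegral_congr_fun measurableSet_Ioi fun v hv => ?_
        rw [mul_invGammaProd hy hv, ENNReal.ofReal_mul (by positivity)]
    _ = _ := by
      rw [lintegral_const_mul' _ _ ENNReal.ofReal_ne_top, lintegral_rpow_mul_exp_neg_div hν0 hr,
        ← ENNReal.ofReal_mul (by positivity)]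
      congr 1
      have e1 : (1 / y + q) / 2 = (1 + q * y) * (2⁻¹ * y⁻¹) := by field_simp
      rw [e1, Real.mul_rpow (by positivity) (by positivity),
        Real.mul_rpow (by positivity) (by positivity), Real.inv_rpow (by positivity),
        Real.inv_rpow hy.le, ← Real.rpow_neg (by positivity), ← Real.rpow_neg hy.le, neg_neg]
      have e2 : y ^ ((ν - 1) / 2) = y ^ (-(ν + 1) / 2) * y ^ ν := by
        rw [← Real.rpow_add hy]; congr 1; ring
      rw [e2]; ring

lemma measurable_invGammaProd (ν q : ℝ) :
    Measurable fun z : ℝ × ℝ => invGammaProd ν q z.1 z.2 := by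
  unfold invGammaProd; fun_prop

/-- The ratio of two inverse gamma variables follows an `F` distribution. -/
lemma lintegral_invGammaProd_le {ν q e : ℝ} (hν : 1 < ν) (hq : 0 < q) :
    ∫⁻ a in Set.Ioi 0, ∫⁻ v in Set.Ioi 0,
      {z : ℝ × ℝ | e * z.1 ≤ z.2}.indicator (fun z => ENNReal.ofReal (invGammaProd ν q z.1 z.2))
        (a, v) =
    ENNReal.ofReal (2 ^ ν * Real.Gamma ((ν + 1) / 2) * Real.Gamma ((ν - 1) / 2) *
      q ^ (-(ν + 1) / 2)) *
    ∫⁻ f in {f : ℝ | e * ((ν + 1) / (ν - 1) / q * f) ≤ 1},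
      ENNReal.ofReal (fDensity (ν + 1) (ν - 1) f) := by
  have hν0 : 0 < ν := by linarith
  have hν1 : 0 < ν - 1 := by linarith
  set E : Set (ℝ × ℝ) := {z | e * z.1 ≤ z.2} with hE
  have hEm : MeasurableSet E :=
    measurableSet_le (f := fun z : ℝ × ℝ => e * z.1) (by fun_prop) (by fun_prop)
  set G : ℝ × ℝ → ℝ≥0∞ := E.indicator (fun z => ENNReal.ofReal (invGammaProd ν q z.1 z.2)) with hG
  have hGm : Measurable G := (measurable_invGammaProd ν q).ennreal_ofReal.indicator hEm
  -- This is the scale for which y = kf turns y^{(ν-1)/2}(1 + qy)^{-ν} into the F density with ν + 1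
  -- and ν - 1 degrees of freedom.
  set k : ℝ := (ν + 1) / (ν - 1) / q with hk
  have hk0 : 0 < k := by positivity
  have hset : MeasurableSet {f : ℝ | e * (k * f) ≤ 1} :=
    measurableSet_le (f := fun f : ℝ => e * (k * f)) (by fun_prop) (by fun_prop)
  calc ∫⁻ a in Set.Ioi 0, ∫⁻ v in Set.Ioi 0, G (a, v)
      = ∫⁻ v in Set.Ioi 0, ∫⁻ a in Set.Ioi 0, G (a, v) :=
        lintegral_lintegral_swap hGm.aemeasurable
    -- Substitute a = vy. The constraint e·a ≤ v becomes e·y ≤ 1 and no longer involves v, so v can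
    -- be integrated out after another exchange of the order.
    _ = ∫⁻ v in Set.Ioi 0, ∫⁻ y in Set.Ioi 0, ENNReal.ofReal v * G (v * y, v) := by
        refine setLIntegral_congr_fun measurableSet_Ioi fun v hv => ?_
        have hv : 0 < v := hv
        rw [← lintegral_indicator measurableSet_Ioi, ← lintegral_comp_mul_left _ hv.ne',
          abs_of_pos hv, lintegral_const_mul' _ _ ENNReal.ofReal_ne_top,
          ← lintegral_indicator measurableSet_Ioi]
        congr 1
        refine lintegral_congr fun y => ?_
        simp only [Set.indicator, Set.mem_Ioi, mul_pos_iff_of_pos_left hv]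
    _ = ∫⁻ y in Set.Ioi 0, ∫⁻ v in Set.Ioi 0, ENNReal.ofReal v * G (v * y, v) :=
        lintegral_lintegral_swap (by fun_prop)
    _ = ∫⁻ y in Set.Ioi 0, {y : ℝ | e * y ≤ 1}.indicator (fun y => ENNReal.ofReal
          (2 ^ ν * Real.Gamma ν * (y ^ ((ν - 1) / 2) * (1 + q * y) ^ (-ν)))) y := by
        refine setLIntegral_congr_fun measurableSet_Ioi fun y hy => ?_
        have hy : 0 < y := hy
        have key : ∀ v ∈ Set.Ioi (0 : ℝ), ENNReal.ofReal v * G (v * y, v) =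
            {y : ℝ | e * y ≤ 1}.indicator (fun y =>
              ENNReal.ofReal (v * invGammaProd ν q (v * y) v)) y := by
          intro v hv
          have hv : 0 < v := hv
          have hiff : (v * y, v) ∈ E ↔ y ∈ {y : ℝ | e * y ≤ 1} := by
            simp only [hE, Set.mem_ofPred_eq]
            rw [show e * (v * y) = v * (e * y) by ring]
            exact mul_le_iff_le_one_right hv
          by_cases hm : y ∈ {y : ℝ | e * y ≤ 1}
          · rw [Set.indicator_of_mem hm, hG, Set.indicator_of_mem (hiff.2 hm),
              ← ENNReal.ofReal_mul hv.le]
          · rw [Set.indicator_of_notMem hm, hG,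
              Set.indicator_of_notMem (fun h => hm (hiff.1 h)), mul_zero]
        rw [setLIntegral_congr_fun measurableSet_Ioi key]
        by_cases hm : y ∈ {y : ℝ | e * y ≤ 1}
        · simp only [Set.indicator_of_mem hm]
          exact lintegral_mul_invGammaProd hν hq hy
        · simp only [Set.indicator_of_notMem hm, lintegral_zero]
    _ = ENNReal.ofReal k * ∫⁻ f, (Set.Ioi (0 : ℝ)).indicator (fun y =>
          {y : ℝ | e * y ≤ 1}.indicator (fun y => ENNReal.ofReal
          (2 ^ ν * Real.Gamma ν * (y ^ ((ν - 1) / 2) * (1 + q * y) ^ (-ν)))) y) (k * f) := by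
        rw [← lintegral_indicator measurableSet_Ioi, ← lintegral_comp_mul_left _ hk0.ne',
          abs_of_pos hk0]
    _ = _ := by
        rw [← lintegral_const_mul' _ _ ENNReal.ofReal_ne_top,
          ← lintegral_const_mul' _ _ ENNReal.ofReal_ne_top, ← lintegral_indicator hset]
        refine lintegral_congr fun f => ?_
        by_cases hm : f ∈ {f : ℝ | e * (k * f) ≤ 1}
        swap
        · rw [Set.indicator_of_notMem hm]
          simp only [Set.indicator]
          split_ifs with h1 h2
          · exact absurd h2 hm
          · simp
          · simp
        rw [Set.indicator_of_mem hm]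
        by_cases hf : 0 < f
        swap
        · rw [fDensity, if_neg hf, Set.indicator_of_notMem]
          · simp
          · rw [Set.mem_Ioi, mul_pos_iff_of_pos_left hk0]; exact hf
        have hG1 := Real.Gamma_pos_of_pos (show 0 < (ν + 1) / 2 by positivity)
        have hG2 := Real.Gamma_pos_of_pos (show 0 < (ν - 1) / 2 by positivity)
        have hG3 := Real.Gamma_pos_of_pos hν0
        have hm' : k * f ∈ {y : ℝ | e * y ≤ 1} := hm
        rw [Set.indicator_of_mem (Set.mem_Ioi.2 (mul_pos hk0 hf)), Set.indicator_of_mem hm',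
          ← ENNReal.ofReal_mul hk0.le, ← ENNReal.ofReal_mul (by positivity), fDensity, if_pos hf]
        congr 1
        have e1 : (ν + 1 + (ν - 1)) / 2 = ν := by ring
        have e2 : -(ν + 1 + (ν - 1)) / 2 = -ν := by ring
        have e3 : (ν + 1) / 2 - 1 = (ν - 1) / 2 := by ring
        have e4 : q * (k * f) = (ν + 1) / (ν - 1) * f := by
          rw [hk]; field_simp
        have e5 : k * k ^ ((ν - 1) / 2) = ((ν + 1) / (ν - 1)) ^ ((ν + 1) / 2) *
            q ^ (-(ν + 1) / 2) := by
          conv_lhs => rw [← Real.rpow_one k, ← Real.rpow_mul hk0.le, one_mul, ← Real.rpow_add hk0]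
          rw [hk, Real.div_rpow (by positivity) hq.le,
            div_eq_mul_inv (((ν + 1) / (ν - 1)) ^ _), ← Real.rpow_neg hq.le]
          congr 2 <;> ring
        rw [e1, e2, e3, e4, Real.mul_rpow hk0.le hf.le]
        calc _ = k * k ^ ((ν - 1) / 2) * (2 ^ ν * Real.Gamma ν *
              (f ^ ((ν - 1) / 2) * (1 + (ν + 1) / (ν - 1) * f) ^ (-ν))) := by ring
          _ = _ := by rw [e5]; field_simp

/-- Taking e = 0 makes the constraint in `lintegral_invGammaProd_le` void. The total F mass, times a
positive constant, is then a product of two finite inverse gamma integrals. -/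
lemma integrable_fDensity {ν : ℝ} (hν : 1 < ν) : Integrable (fDensity (ν + 1) (ν - 1)) := by
  have hν1 : 0 < ν - 1 := by linarith
  have hν0 : 0 < ν := by linarith
  refine ⟨(measurable_fDensity _ _).aestronglyMeasurable, ?_⟩
  rw [hasFiniteIntegral_iff_ofReal (ae_of_all _ (fDensity_nonneg (by linarith) hν1))]
  have h := lintegral_invGammaProd_le (e := 0) hν one_pos
  have huniv : {f : ℝ | 0 * ((ν + 1) / (ν - 1) / 1 * f) ≤ 1} = Set.univ := by
    ext; simp
  rw [huniv, setLIntegral_univ] at h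
  have hlt : ∫⁻ a in Set.Ioi 0, ∫⁻ v in Set.Ioi 0,
      {z : ℝ × ℝ | 0 * z.1 ≤ z.2}.indicator (fun z => ENNReal.ofReal (invGammaProd ν 1 z.1 z.2))
        (a, v) < ∞ := by
    calc _ = ∫⁻ a in Set.Ioi 0, ∫⁻ v in Set.Ioi 0,
          ENNReal.ofReal (a ^ (-((ν - 1) / 2) - 1) * Real.exp (-(1 / 2 / a))) *
          ENNReal.ofReal (v ^ (-((ν + 1) / 2) - 1) * Real.exp (-(1 / 2 / v))) := by
          refine setLIntegral_congr_fun measurableSet_Ioi fun a ha => ?_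
          refine setLIntegral_congr_fun measurableSet_Ioi fun v hv => ?_
          have ha : 0 < a := ha
          have hv : 0 < v := hv
          rw [Set.indicator_of_mem (by simpa using hv.le), ← ENNReal.ofReal_mul (by positivity),
            invGammaProd, show -((ν - 1) / 2) - 1 = -(ν + 1) / 2 by ring,
            show -((ν + 1) / 2) - 1 = -(ν + 3) / 2 by ring]
          congr 1
          ring
      _ < ∞ := by
          simp_rw [lintegral_const_mul' _ _ ENNReal.ofReal_ne_top]
          rw [lintegral_mul_const _ (by fun_prop),
            lintegral_rpow_mul_exp_neg_div (by linarith) (by norm_num),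
            lintegral_rpow_mul_exp_neg_div (by linarith) (by norm_num)]
          exact ENNReal.mul_lt_top ENNReal.ofReal_lt_top ENNReal.ofReal_lt_top
  rw [h] at hlt
  have hG1 := Real.Gamma_pos_of_pos (show 0 < (ν + 1) / 2 by positivity)
  have hG2 := Real.Gamma_pos_of_pos (show 0 < (ν - 1) / 2 by positivity)
  refine lt_top_iff_ne_top.2 fun ht => ?_
  rw [ht, ENNReal.mul_top] at hlt
  · exact absurd hlt (lt_irrefl _)
  · exact (ENNReal.ofReal_pos.2 (by positivity)).ne'

lemma ofReal_fCDF {ν : ℝ} (hν : 1 < ν) (x : ℝ) :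
    ENNReal.ofReal (fCDF (ν + 1) (ν - 1) x) =
      ∫⁻ f in Set.Iic x, ENNReal.ofReal (fDensity (ν + 1) (ν - 1) f) :=
  ofReal_integral_eq_lintegral_ofReal (integrable_fDensity hν).integrableOn
    (ae_of_all _ (fDensity_nonneg (by linarith) (by linarith)))

lemma fCDF_nonneg {ν : ℝ} (hν : 1 < ν) (x : ℝ) : 0 ≤ fCDF (ν + 1) (ν - 1) x :=
  integral_nonneg (fDensity_nonneg (by linarith) (by linarith))

lemma monotone_fCDF {ν : ℝ} (hν : 1 < ν) : Monotone (fCDF (ν + 1) (ν - 1)) := fun _ _ h =>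
  setIntegral_mono_set (integrable_fDensity hν).integrableOn
    (ae_of_all _ (fDensity_nonneg (by linarith) (by linarith)))
    (LE.le.eventuallyLE (Set.Iic_subset_Iic.2 h))

/-! ### The half regions and the function `I` -/

/-- The part of the region for slope `b > 0` on which `b² Σ₁₁ ≤ Σ₂₂`. -/
def halfSet (b : ℝ) : Set (ℝ × ℝ × ℝ) :=
  {s | 0 < s.1 ∧ 0 < symDet s ∧ 0 ≤ s.2.1 ∧ s.2.1 ≤ b * s.1 ∧ b ^ 2 * s.1 ≤ s.2.2}

lemma measurableSet_halfSet (b : ℝ) : MeasurableSet (halfSet b) := by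
  unfold halfSet
  simp only [Set.ofPred_and]
  exact (measurableSet_lt (f := fun _ : ℝ × ℝ × ℝ => (0 : ℝ)) (by fun_prop) (by fun_prop)).inter <|
    (measurableSet_lt (f := fun _ : ℝ × ℝ × ℝ => (0 : ℝ)) (by fun_prop) (by fun_prop)).inter <|
    (measurableSet_le (f := fun _ : ℝ × ℝ × ℝ => (0 : ℝ)) (g := fun s => s.2.1)
      (by fun_prop) (by fun_prop)).inter <|
    (measurableSet_le (f := fun s : ℝ × ℝ × ℝ => s.2.1) (g := fun s => b * s.1)
      (by fun_prop) (by fun_prop)).inter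
    (measurableSet_le (f := fun s : ℝ × ℝ × ℝ => b ^ 2 * s.1) (g := fun s => s.2.2)
      (by fun_prop) (by fun_prop))

/-- Integral of the kernel over the half region. -/
def halfInt (b m : ℝ) (P : ℝ × ℝ × ℝ) : ℝ≥0∞ :=
  ∫⁻ s, (halfSet b).indicator (fun s => ENNReal.ofReal (kernel m P s)) s

lemma lintegral_triple_swap {f : ℝ × ℝ × ℝ → ℝ≥0∞} (hf : Measurable f) :
    ∫⁻ s : ℝ × ℝ × ℝ, f (s.2.2, s.2.1, s.1) = ∫⁻ s, f s := by
  rw [lintegral_triple hf, lintegral_triple (by fun_prop)]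
  simp only
  calc ∫⁻ a, ∫⁻ h, ∫⁻ d, f (d, h, a) = ∫⁻ h, ∫⁻ a, ∫⁻ d, f (d, h, a) := by
        refine lintegral_lintegral_swap (Measurable.aemeasurable ?_)
        exact Measurable.lintegral_prod_right' (f := fun z : (ℝ × ℝ) × ℝ => f (z.2, z.1.2, z.1.1))
          (by fun_prop)
    _ = ∫⁻ h, ∫⁻ d, ∫⁻ a, f (d, h, a) := by
        refine lintegral_congr fun h => lintegral_lintegral_swap (by fun_prop)
    _ = ∫⁻ d, ∫⁻ h, ∫⁻ a, f (d, h, a) := by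
        refine lintegral_lintegral_swap (Measurable.aemeasurable ?_)
        exact Measurable.lintegral_prod_right' (f := fun z : (ℝ × ℝ) × ℝ => f (z.1.2, z.1.1, z.2))
          (by fun_prop)

/-- The common boundary of the two half regions is negligible. -/
lemma volume_setOf_mul_fst_eq (k : ℝ) : volume {s : ℝ × ℝ × ℝ | k * s.1 = s.2.2} = 0 := by
  have hm : MeasurableSet {s : ℝ × ℝ × ℝ | k * s.1 = s.2.2} :=
    measurableSet_eq_fun (by fun_prop) (by fun_prop)
  rw [Measure.volume_eq_prod, Measure.measure_prod_null hm]
  refine ae_of_all _ fun a => ?_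
  change volume (Prod.mk a ⁻¹' _) = 0
  have : Prod.mk a ⁻¹' {s : ℝ × ℝ × ℝ | k * s.1 = s.2.2} = Set.univ ×ˢ {k * a} := by
    ext z
    simp [eq_comm]
  rw [this, Measure.volume_eq_prod, Measure.prod_prod]
  simp

/-- Cut the region along b²Σ₁₁ = Σ₂₂. Where b²Σ₁₁ ≤ Σ₂₂ the constraint bΣ₁₂ ≤ Σ₂₂ follows from Σ₁₂ ≤
bΣ₁₁; on the other side the roles are reversed. Exchanging the coordinates maps that side to the
half region for 1/b and preserves the kernel because the precision has equal diagonal entries. -/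
lemma kernelInt_eq_halfInt_add {b : ℝ} (hb : 0 < b) (m r : ℝ) :
    kernelInt b m (1, r, 1) = halfInt b m (1, r, 1) + halfInt b⁻¹ m (1, r, 1) := by
  set F : ℝ × ℝ × ℝ → ℝ≥0∞ := fun s => ENNReal.ofReal (kernel m (1, r, 1) s) with hF
  have hFm : Measurable F := (measurable_kernel m (1, r, 1)).ennreal_ofReal
  have hT : MeasurableSet {s : ℝ × ℝ × ℝ | b ^ 2 * s.1 ≤ s.2.2} :=
    measurableSet_le (by fun_prop) (by fun_prop)
  have hdiv : ∀ u, 0 ≤ u / b ↔ 0 ≤ u := fun u => by rw [le_div_iff₀ hb, zero_mul]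
  have h1 : regionSet b ∩ {s | b ^ 2 * s.1 ≤ s.2.2} = halfSet b := by
    ext s
    simp only [regionSet, halfSet, Set.mem_inter_iff, Set.mem_ofPred_eq]
    rw [hdiv, div_le_iff₀ hb]
    constructor
    · rintro ⟨⟨h1, h2, h3, h4, h5⟩, h6⟩
      exact ⟨h1, h2, h3, by linarith, h6⟩
    · rintro ⟨h1, h2, h3, h4, h5⟩
      exact ⟨⟨h1, h2, h3, by linarith, by nlinarith⟩, h5⟩
  -- The two sets agree only almost everywhere: the complement has a strict inequality, the half
  -- region a weak one.
  have h2 : (regionSet b \ {s | b ^ 2 * s.1 ≤ s.2.2} : Set (ℝ × ℝ × ℝ)) =ᵐ[volume]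
      (fun s : ℝ × ℝ × ℝ => (s.2.2, s.2.1, s.1)) ⁻¹' halfSet b⁻¹ := by
    have hne : ∀ᵐ s : ℝ × ℝ × ℝ, b ^ 2 * s.1 ≠ s.2.2 := by
      rw [ae_iff]; simpa using volume_setOf_mul_fst_eq (b ^ 2)
    filter_upwards [hne] with s hs
    apply propext
    change s ∈ (regionSet b \ {s | b ^ 2 * s.1 ≤ s.2.2} : Set (ℝ × ℝ × ℝ)) ↔
      s ∈ (fun s : ℝ × ℝ × ℝ => (s.2.2, s.2.1, s.1)) ⁻¹' halfSet b⁻¹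
    simp only [regionSet, halfSet, Set.mem_sdiff, Set.mem_preimage, Set.mem_ofPred_eq, symDet]
    rw [hdiv, div_le_iff₀ hb, inv_mul_eq_div, le_div_iff₀ hb,
      inv_pow, inv_mul_eq_div, div_le_iff₀ (by positivity), not_le]
    constructor
    · rintro ⟨⟨h1, h2, h3, h4, h5⟩, h6⟩
      refine ⟨?_, by linarith, h3, by linarith, by linarith⟩
      nlinarith
    · rintro ⟨h1, h2, h3, h4, h5⟩
      have h6 : s.2.2 < b ^ 2 * s.1 := lt_of_le_of_ne (by linarith) hs.symm
      refine ⟨⟨?_, by linarith, h3, ?_, by linarith⟩, h6⟩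
      · by_contra h
        nlinarith [sq_nonneg b]
      · have : b * s.2.1 ≤ b * (s.1 * b) := by nlinarith
        exact le_of_mul_le_mul_left this hb
  rw [kernelInt_eq_setLIntegral, ← lintegral_inter_add_sdiff _ _ hT, h1, setLIntegral_congr h2,
    halfInt, lintegral_indicator (measurableSet_halfSet b), halfInt]
  congr 1
  rw [← lintegral_triple_swap (hFm.indicator (measurableSet_halfSet _)),
    ← lintegral_indicator]
  · refine lintegral_congr fun s => ?_
    have : F s = F (s.2.2, s.2.1, s.1) := by
      simp only [hF, kernel, symDet]
      ring_nf
    by_cases hs : (s.2.2, s.2.1, s.1) ∈ halfSet b⁻¹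
    · have hs' : s ∈ (fun s : ℝ × ℝ × ℝ => (s.2.2, s.2.1, s.1)) ⁻¹' halfSet b⁻¹ := hs
      rw [Set.indicator_of_mem hs, Set.indicator_of_mem hs']
      exact this
    · have hs' : s ∉ (fun s : ℝ × ℝ × ℝ => (s.2.2, s.2.1, s.1)) ⁻¹' halfSet b⁻¹ := hs
      rw [Set.indicator_of_notMem hs, Set.indicator_of_notMem hs']
  · exact (measurableSet_halfSet _).preimage (by fun_prop)

/-- Proportionality factor between the integral over a half region and the function `I`. -/
def halfConst (ν r : ℝ) : ℝ :=
  2 ^ ν * Real.Gamma ((ν + 1) / 2) * Real.Gamma ((ν - 1) / 2) * (1 - r ^ 2) ^ (-(ν + 1) / 2) *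
    (Real.sqrt (1 - r ^ 2) / Real.sqrt ν) /
    (Real.Gamma ((ν + 1) / 2) / (Real.sqrt (ν * Real.pi) * Real.Gamma (ν / 2)))

lemma halfConst_pos {ν r : ℝ} (hν : 1 < ν) (hr : r ^ 2 < 1) : 0 < halfConst ν r := by
  have hG1 := Real.Gamma_pos_of_pos (show 0 < (ν + 1) / 2 by linarith)
  have hG2 := Real.Gamma_pos_of_pos (show 0 < (ν - 1) / 2 by linarith)
  have hG3 := Real.Gamma_pos_of_pos (show 0 < ν / 2 by linarith)
  have hr' : 0 < 1 - r ^ 2 := by linarith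
  have hν0 : 0 < ν := by linarith
  unfold halfConst
  positivity

/-- The integrand of the half region integral after integrating out `Σ₁₁` and `Σ₂₂`. -/
lemma lintegral_halfSet_section {ν r b x : ℝ} (hν : 1 < ν) (hr : r ^ 2 < 1)
    (hx : x ∈ Set.Ioo 0 b) :
    ∫⁻ a in Set.Ioi 0, ∫⁻ v, ENNReal.ofReal a * (halfSet b).indicator
      (fun s => ENNReal.ofReal (kernel ν (1, r, 1) s)) (a, a * x, v + x ^ 2 * a) =
    ENNReal.ofReal (2 ^ ν * Real.Gamma ((ν + 1) / 2) * Real.Gamma ((ν - 1) / 2) *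
      (x ^ 2 - 2 * r * x + 1) ^ (-(ν + 1) / 2) *
      fCDF (ν + 1) (ν - 1) ((ν - 1) / (ν + 1) * ((x ^ 2 - 2 * r * x + 1) / (b ^ 2 - x ^ 2)))) := by
  have hG1 := Real.Gamma_pos_of_pos (show 0 < (ν + 1) / 2 by linarith)
  have hG2 := Real.Gamma_pos_of_pos (show 0 < (ν - 1) / 2 by linarith)
  have hν1 : 0 < ν - 1 := by linarith
  have hν2 : 0 < ν + 1 := by linarith
  set q := x ^ 2 - 2 * r * x + 1 with hq
  have hq0 : 0 < q := by nlinarith [sq_nonneg (x - r)]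
  have he : 0 < b ^ 2 - x ^ 2 := by nlinarith [hx.1, hx.2]
  rw [ENNReal.ofReal_mul (by positivity), ofReal_fCDF hν]
  have hset : Set.Iic ((ν - 1) / (ν + 1) * (q / (b ^ 2 - x ^ 2))) =
      {f : ℝ | (b ^ 2 - x ^ 2) * ((ν + 1) / (ν - 1) / q * f) ≤ 1} := by
    ext f
    simp only [Set.mem_Iic, Set.mem_ofPred_eq]
    rw [show (b ^ 2 - x ^ 2) * ((ν + 1) / (ν - 1) / q * f) =
      f / ((ν - 1) / (ν + 1) * (q / (b ^ 2 - x ^ 2))) by field_simp, div_le_one (by positivity)]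
  rw [hset, ← lintegral_invGammaProd_le hν hq0]
  refine setLIntegral_congr_fun measurableSet_Ioi fun a ha => ?_
  have ha : 0 < a := ha
  rw [← lintegral_indicator measurableSet_Ioi]
  refine lintegral_congr fun v => ?_
  -- With 0 < x < b fixed, the constraints on Σ₁₂ hold automatically and b²Σ₁₁ ≤ Σ₂₂ reads (b² -
  -- x²)a ≤ v. Only a bound on the ratio a/v remains.
  have hiff : (a, a * x, v + x ^ 2 * a) ∈ halfSet b ↔
      v ∈ Set.Ioi 0 ∧ (a, v) ∈ {z : ℝ × ℝ | (b ^ 2 - x ^ 2) * z.1 ≤ z.2} := by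
    simp only [halfSet, Set.mem_ofPred_eq, symDet_regression, Set.mem_Ioi,
      mul_pos_iff_of_pos_left ha]
    constructor
    · rintro ⟨-, h2, -, -, h5⟩
      exact ⟨h2, by linarith⟩
    · rintro ⟨h2, h5⟩
      exact ⟨ha, h2, mul_nonneg ha.le hx.1.le, by nlinarith [hx.2], by linarith⟩
  by_cases hv : v ∈ Set.Ioi (0 : ℝ)
  · rw [Set.indicator_of_mem hv]
    by_cases hz : (a, v) ∈ {z : ℝ × ℝ | (b ^ 2 - x ^ 2) * z.1 ≤ z.2}
    · rw [Set.indicator_of_mem hz, Set.indicator_of_mem (hiff.2 ⟨hv, hz⟩),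
        ← ENNReal.ofReal_mul ha.le, mul_kernel_regression ν _ x ha hv, invGammaProd, hq]
      simp only [one_mul]
    · rw [Set.indicator_of_notMem hz, Set.indicator_of_notMem (fun h => hz (hiff.1 h).2), mul_zero]
  · rw [Set.indicator_of_notMem hv, Set.indicator_of_notMem (fun h => hv (hiff.1 h).1), mul_zero]

/-- After a and v are integrated out, an integral over 0 < x < b of (x² - 2rx + 1)^{-(ν+1)/2} times
an F distribution function remains. The substitution x = r + kt with k = √((1 - r²)/ν) completes the
square, turning the power into a Student t density and the limits 0 and b into t₋ and t₊. -/
lemma halfInt_eq {ν r b : ℝ} (hν : 1 < ν) (hr : r ^ 2 < 1) :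
    halfInt b ν (1, r, 1) = ENNReal.ofReal (halfConst ν r) *
      ∫⁻ t in Set.Ioo (tMinus ν r) (tPlus b ν r), ENNReal.ofReal (integrandI b ν r t) := by
  have hν0 : 0 < ν := by linarith
  have hr' : 0 < 1 - r ^ 2 := by linarith
  have hG1 := Real.Gamma_pos_of_pos (show 0 < (ν + 1) / 2 by linarith)
  have hG2 := Real.Gamma_pos_of_pos (show 0 < (ν - 1) / 2 by linarith)
  have hG3 := Real.Gamma_pos_of_pos (show 0 < ν / 2 by linarith)
  set k := Real.sqrt (1 - r ^ 2) / Real.sqrt ν with hk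
  have hk0 : 0 < k := by positivity
  have hkm : k * tMinus ν r = -r := by
    rw [hk, tMinus]; field_simp
  have hkp : k * tPlus b ν r = b - r := by
    rw [hk, tPlus]; field_simp
  have hk2 : k ^ 2 * ν = 1 - r ^ 2 := by
    rw [hk, div_pow, Real.sq_sqrt hr'.le, Real.sq_sqrt hν0.le]; field_simp
  calc halfInt b ν (1, r, 1)
      = ∫⁻ x, ∫⁻ a in Set.Ioi 0, ∫⁻ v, ENNReal.ofReal a * (halfSet b).indicator
          (fun s => ENNReal.ofReal (kernel ν (1, r, 1) s)) (a, a * x, v + x ^ 2 * a) := by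
        refine lintegral_regression_coords
          ((measurable_kernel _ _).ennreal_ofReal.indicator (measurableSet_halfSet b))
            fun s hs => ?_
        exact Set.indicator_of_notMem (fun h => absurd h.1 hs.not_gt) _
    _ = ∫⁻ x in Set.Ioo 0 b, ∫⁻ a in Set.Ioi 0, ∫⁻ v, ENNReal.ofReal a * (halfSet b).indicator
          (fun s => ENNReal.ofReal (kernel ν (1, r, 1) s)) (a, a * x, v + x ^ 2 * a) := by
        rw [setLIntegral_congr Ioo_ae_eq_Icc, ← lintegral_indicator measurableSet_Icc]
        refine lintegral_congr fun x => ?_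
        by_cases hx : x ∈ Set.Icc (0 : ℝ) b
        · rw [Set.indicator_of_mem hx]
        · rw [Set.indicator_of_notMem hx, setLIntegral_eq_zero measurableSet_Ioi]
          intro a ha
          have ha : 0 < a := ha
          simp only [Pi.zero_apply]
          refine lintegral_eq_zero_of_ae_eq_zero (ae_of_all _ fun v => ?_)
          have : (a, a * x, v + x ^ 2 * a) ∉ halfSet b := by
            intro h
            apply hx
            have h1 := h.2.2.1
            have h2 := h.2.2.2.1
            simp only at h1 h2
            exact ⟨by rwa [mul_nonneg_iff_of_pos_left ha] at h1,
              le_of_mul_le_mul_left (by linarith) ha⟩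
          simp [Set.indicator_of_notMem this]
    _ = ∫⁻ x in Set.Ioo 0 b, ENNReal.ofReal
          (2 ^ ν * Real.Gamma ((ν + 1) / 2) * Real.Gamma ((ν - 1) / 2) *
          (x ^ 2 - 2 * r * x + 1) ^ (-(ν + 1) / 2) * fCDF (ν + 1) (ν - 1)
            ((ν - 1) / (ν + 1) * ((x ^ 2 - 2 * r * x + 1) / (b ^ 2 - x ^ 2)))) :=
        setLIntegral_congr_fun measurableSet_Ioo fun x hx => lintegral_halfSet_section hν hr hx
    _ = _ := by
        rw [← lintegral_indicator measurableSet_Ioo, ← lintegral_comp_mul_left _ hk0.ne',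
          ← lintegral_sub_right_eq_self _ (tMinus ν r), ← lintegral_indicator measurableSet_Ioo,
          ← lintegral_const_mul' _ _ ENNReal.ofReal_ne_top,
          ← lintegral_const_mul' _ _ ENNReal.ofReal_ne_top, abs_of_pos hk0]
        refine lintegral_congr fun t => ?_
        have hxt : k * (t - tMinus ν r) = k * t + r := by rw [mul_sub, hkm]; ring
        have hiff : k * (t - tMinus ν r) ∈ Set.Ioo 0 b ↔
            t ∈ Set.Ioo (tMinus ν r) (tPlus b ν r) := by
          rw [Set.mem_Ioo, Set.mem_Ioo, mul_pos_iff_of_pos_left hk0, sub_pos,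
            ← mul_lt_mul_iff_right₀ hk0 (b := t), hkp, mul_sub, hkm]
          constructor <;> rintro ⟨h1, h2⟩ <;> exact ⟨h1, by linarith⟩
        by_cases ht : t ∈ Set.Ioo (tMinus ν r) (tPlus b ν r)
        swap
        · rw [Set.indicator_of_notMem ht, Set.indicator_of_notMem (fun h => ht (hiff.1 h)),
            mul_zero, mul_zero]
        rw [Set.indicator_of_mem ht, Set.indicator_of_mem (hiff.2 ht),
          ← ENNReal.ofReal_mul hk0.le, ← ENNReal.ofReal_mul (halfConst_pos hν hr).le, hxt]
        congr 1
        -- The value of k is chosen so that k²ν = 1 - r², which makes the completed square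
        -- proportional to 1 + t²/ν.
        have hq : (k * t + r) ^ 2 - 2 * r * (k * t + r) + 1 = (1 - r ^ 2) * (1 + t ^ 2 / ν) := by
          field_simp
          linear_combination (t ^ 2) * hk2
        have hFarg : (ν - 1) / (ν + 1) * (((k * t + r) ^ 2 - 2 * r * (k * t + r) + 1) /
            (b ^ 2 - (k * t + r) ^ 2)) = fArg t b ν r := by
          have hp : tPlus b ν r - tMinus ν r = b / k := by
            rw [eq_div_iff hk0.ne']; linarith
          have hm : t - tMinus ν r = (k * t + r) / k := by
            rw [eq_div_iff hk0.ne']; linarith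
          rw [fArg, hp, hm, hq, ← hk2, div_pow b, div_pow (k * t + r), ← sub_div]
          congr 1
          field_simp
        rw [hFarg, hq, Real.mul_rpow hr'.le (by positivity), integrandI, tDensity, halfConst, ← hk]
        field_simp

lemma integrandI_nonneg {ν : ℝ} (hν : 1 < ν) (b r t : ℝ) : 0 ≤ integrandI b ν r t := by
  have hν0 : 0 < ν := by linarith
  have hG1 := Real.Gamma_pos_of_pos (show 0 < (ν + 1) / 2 by linarith)
  have hG3 := Real.Gamma_pos_of_pos (show 0 < ν / 2 by linarith)
  refine mul_nonneg ?_ (fCDF_nonneg hν _)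
  unfold tDensity
  positivity

lemma measurable_integrandI {ν : ℝ} (hν : 1 < ν) (b r : ℝ) : Measurable (integrandI b ν r) := by
  unfold integrandI
  refine Measurable.mul (by unfold tDensity; fun_prop) ?_
  exact (monotone_fCDF hν).measurable.comp (by unfold fArg; fun_prop)

lemma tMinus_le_tPlus {ν r b : ℝ} (hb : 0 ≤ b) : tMinus ν r ≤ tPlus b ν r := by
  unfold tMinus tPlus
  refine div_le_div_of_nonneg_right ?_ (Real.sqrt_nonneg _)
  nlinarith [mul_nonneg (Real.sqrt_nonneg ν) hb]

lemma intervalIntegrable_integrandI {ν r b : ℝ} (hν : 1 < ν) (hr : r ^ 2 < 1) (hb : 0 < b)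
    (hfin : halfInt b ν (1, r, 1) < ∞) :
    IntervalIntegrable (integrandI b ν r) volume (tMinus ν r) (tPlus b ν r) := by
  rw [intervalIntegrable_iff_integrableOn_Ioo_of_le (tMinus_le_tPlus hb.le)]
  refine ⟨(measurable_integrandI hν b r).aestronglyMeasurable, ?_⟩
  rw [hasFiniteIntegral_iff_ofReal (ae_of_all _ (integrandI_nonneg hν b r))]
  rw [halfInt_eq hν hr] at hfin
  refine lt_top_iff_ne_top.2 fun ht => ?_
  rw [ht, ENNReal.mul_top (ENNReal.ofReal_pos.2 (halfConst_pos hν hr)).ne'] at hfin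
  exact absurd hfin (lt_irrefl _)

lemma toReal_halfInt {ν r b : ℝ} (hν : 1 < ν) (hr : r ^ 2 < 1) (hb : 0 < b) :
    (halfInt b ν (1, r, 1)).toReal = halfConst ν r * funI b ν r := by
  rw [halfInt_eq hν hr, ENNReal.toReal_mul, ENNReal.toReal_ofReal (halfConst_pos hν hr).le, funI,
    intervalIntegral.integral_of_le (tMinus_le_tPlus hb.le), integral_Ioc_eq_integral_Ioo,
    integral_eq_lintegral_of_nonneg_ae (ae_of_all _ (integrandI_nonneg hν b r))
      (measurable_integrandI hν b r).aestronglyMeasurable]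

/-! ### Integrating out the location parameters -/

lemma normalDensity_symMat (m₁ m₂ x₁ x₂ : ℝ) (s : ℝ × ℝ × ℝ) :
    normalDensity m₁ m₂ (symMat s) x₁ x₂ =
      (2 * Real.pi)⁻¹ * symDet s ^ (-(1 / 2) : ℝ) * Real.exp (-(1 / 2) *
        ((s.2.2 * (x₁ - m₁) ^ 2 - 2 * s.2.1 * ((x₁ - m₁) * (x₂ - m₂)) + s.1 * (x₂ - m₂) ^ 2) /
          symDet s)) := by
  have hd : (symMat s).det = symDet s := by
    rw [symMat, Matrix.det_fin_two_of, symDet]; ring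
  rw [normalDensity, Matrix.inv_def, hd]
  congr 3
  simp only [symMat, Matrix.adjugate_fin_two_of, dotProduct, Matrix.mulVec,
    Fin.sum_univ_two, Matrix.smul_apply, Matrix.of_apply, Matrix.cons_val', Matrix.cons_val_zero,
    Matrix.cons_val_one, Matrix.cons_val_fin_one, smul_eq_mul, Ring.inverse_eq_inv']
  ring

/-- Centering at the sample means kills the cross terms. The hypothesis on n makes the divisor n - 1
nonzero. -/
lemma sum_sub_mul_sub {n : ℕ} (hn : 1 < n) (x z : Fin n → ℝ) (m m' : ℝ) :
    ∑ i, (x i - m) * (z i - m') =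
      ((n : ℝ) - 1) * sampleCov x z + n * ((sampleMean x - m) * (sampleMean z - m')) := by
  have hn0 : (n : ℝ) ≠ 0 := by positivity
  have hn1 : (n : ℝ) - 1 ≠ 0 := by
    have : (1 : ℝ) < n := by exact_mod_cast hn
    linarith
  have hx : ∑ i, x i = n * sampleMean x := by rw [sampleMean]; field_simp
  have hz : ∑ i, z i = n * sampleMean z := by rw [sampleMean]; field_simp
  rw [sampleCov, mul_div_cancel₀ _ hn1]
  have h1 : ∀ a b : ℝ, ∑ i, (x i - a) * (z i - b) =
      ∑ i, x i * z i - b * ∑ i, x i - a * ∑ i, z i + n * (a * b) := by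
    intro a b
    simp only [sub_mul, mul_sub, Finset.sum_sub_distrib, Finset.mul_sum, Finset.sum_const,
      Finset.card_univ, Fintype.card_fin, nsmul_eq_mul, mul_comm (x _) b]
    ring
  rw [h1, h1, hx, hz]
  ring

/-- The sample covariances `(S₁₁, S₁₂, S₂₂)`. -/
def covTriple {n : ℕ} (y₁ y₂ : Fin n → ℝ) : ℝ × ℝ × ℝ :=
  (sampleCov y₁ y₁, sampleCov y₁ y₂, sampleCov y₂ y₂)

/-- The quadratic form of Σ⁻¹ at the difference of the means is completed to a square in m₂ given m₁
plus a square in m₁, so that both location integrals are one-dimensional Gaussians. -/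
lemma prod_normalDensity {n : ℕ} (hn : 1 < n) (y₁ y₂ : Fin n → ℝ) (m₁ m₂ : ℝ) {s : ℝ × ℝ × ℝ}
    (h1 : 0 < s.1) (hD : 0 < symDet s) :
    ∏ i, normalDensity m₁ m₂ (symMat s) (y₁ i) (y₂ i) =
      ((2 * Real.pi)⁻¹ * symDet s ^ (-(1 / 2) : ℝ)) ^ n * Real.exp (-(1 / 2) *
        (((n : ℝ) - 1) * (sampleCov y₁ y₁ * s.2.2 - 2 * sampleCov y₁ y₂ * s.2.1 +
          sampleCov y₂ y₂ * s.1) / symDet s)) *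
      (Real.exp (-(n * s.1 / (2 * symDet s)) *
        (m₂ - (sampleMean y₂ - s.2.1 * (sampleMean y₁ - m₁) / s.1)) ^ 2) *
      Real.exp (-(n / (2 * s.1)) * (m₁ - sampleMean y₁) ^ 2)) := by
  simp_rw [normalDensity_symMat]
  rw [Finset.prod_mul_distrib, Finset.prod_const, Finset.card_univ, Fintype.card_fin,
    ← Real.exp_sum, mul_assoc, ← Real.exp_add, ← Real.exp_add]
  congr 2
  rw [← Finset.mul_sum, ← Finset.sum_div, Finset.sum_add_distrib, Finset.sum_sub_distrib,
    ← Finset.mul_sum, ← Finset.mul_sum, ← Finset.mul_sum]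
  simp only [pow_two (y₁ _ - m₁), pow_two (y₂ _ - m₂)]
  rw [sum_sub_mul_sub hn, sum_sub_mul_sub hn, sum_sub_mul_sub hn]
  generalize sampleMean y₁ = e1
  generalize sampleMean y₂ = e2
  have hD' := hD.ne'
  field_simp
  simp only [symDet]
  ring

/-- Translation invariance in α removes the shift βμ₁. The two Gaussian integrals then yield
(2π/n)|Σ|^{1/2}, which accounts for the loss of one degree of freedom. -/
lemma lintegral_location {n : ℕ} (hn : 1 < n) (y₁ y₂ : Fin n → ℝ) (β : ℝ) {s : ℝ × ℝ × ℝ}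
    (h1 : 0 < s.1) (hD : 0 < symDet s) :
    ∫⁻ μ, ∫⁻ α, ENNReal.ofReal (∏ i, normalDensity μ (α + β * μ) (symMat s) (y₁ i) (y₂ i)) =
      ENNReal.ofReal (((2 * Real.pi)⁻¹ ^ n * (2 * Real.pi / n)) *
        (symDet s ^ (-((n : ℝ) - 1) / 2) * Real.exp (-(1 / 2) *
        (((n : ℝ) - 1) * (sampleCov y₁ y₁ * s.2.2 - 2 * sampleCov y₁ y₂ * s.2.1 +
          sampleCov y₂ y₂ * s.1) / symDet s)))) := by
  have hn0 : (0 : ℝ) < n := by positivity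
  have hpi := Real.pi_pos
  set A : ℝ := ((2 * Real.pi)⁻¹ * symDet s ^ (-(1 / 2) : ℝ)) ^ n * Real.exp (-(1 / 2) *
        (((n : ℝ) - 1) * (sampleCov y₁ y₁ * s.2.2 - 2 * sampleCov y₁ y₂ * s.2.1 +
          sampleCov y₂ y₂ * s.1) / symDet s)) with hA
  have hA0 : 0 ≤ A := by positivity
  calc _ = ∫⁻ μ, ∫⁻ m, ENNReal.ofReal (∏ i, normalDensity μ m (symMat s) (y₁ i) (y₂ i)) := by
        refine lintegral_congr fun μ => ?_
        rw [lintegral_add_right_eq_self (fun m =>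
          ENNReal.ofReal (∏ i, normalDensity μ m (symMat s) (y₁ i) (y₂ i)))]
    _ = ∫⁻ μ, ∫⁻ m, ENNReal.ofReal A * (ENNReal.ofReal (Real.exp (-(n * s.1 / (2 * symDet s)) *
          (m - (sampleMean y₂ - s.2.1 * (sampleMean y₁ - μ) / s.1)) ^ 2)) *
          ENNReal.ofReal (Real.exp (-(n / (2 * s.1)) * (μ - sampleMean y₁) ^ 2))) := by
        refine lintegral_congr fun μ => lintegral_congr fun m => ?_
        rw [prod_normalDensity hn y₁ y₂ μ m h1 hD, ← ENNReal.ofReal_mul (by positivity),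
          ← ENNReal.ofReal_mul hA0]
    _ = ENNReal.ofReal A * (ENNReal.ofReal (Real.sqrt (Real.pi / (n * s.1 / (2 * symDet s)))) *
          ENNReal.ofReal (Real.sqrt (Real.pi / (n / (2 * s.1))))) := by
        simp_rw [lintegral_const_mul' _ _ ENNReal.ofReal_ne_top,
          lintegral_mul_const' _ _ ENNReal.ofReal_ne_top,
          lintegral_exp_neg_mul_sub_sq (show 0 < n * s.1 / (2 * symDet s) by positivity),
          lintegral_const_mul' _ _ ENNReal.ofReal_ne_top,
          lintegral_exp_neg_mul_sub_sq (show 0 < n / (2 * s.1) by positivity)]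
    _ = _ := by
        rw [← ENNReal.ofReal_mul (by positivity), ← ENNReal.ofReal_mul hA0]
        congr 1
        rw [← Real.sqrt_mul (by positivity)]
        have e1 : Real.pi / (n * s.1 / (2 * symDet s)) * (Real.pi / (n / (2 * s.1))) =
            (2 * Real.pi / n) ^ 2 * symDet s := by
          field_simp
        have e2 : symDet s ^ (-((n : ℝ) - 1) / 2) =
            (symDet s ^ (-(1 / 2) : ℝ)) ^ n * symDet s ^ (1 / 2 : ℝ) := by
          rw [← Real.rpow_natCast, ← Real.rpow_mul hD.le, ← Real.rpow_add hD]
          congr 1; ring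
        rw [e1, Real.sqrt_mul (by positivity), Real.sqrt_sq (by positivity), Real.sqrt_eq_rpow, e2,
          hA, mul_pow]
        ring

/-! ### The reduced sampling density -/

/-- `(Σ₁₁, Σ₁₂, Σ₂₂)` as a function of the variance parameters. -/
def covParams (β : ℝ) (w : ℝ × ℝ × ℝ) : ℝ × ℝ × ℝ :=
  (w.1 + w.2.1, β * w.1, β ^ 2 * w.1 + w.2.2)

lemma covModel_eq_symMat (β τ2 s1 s2 : ℝ) :
    covModel β τ2 s1 s2 = symMat (covParams β (τ2, s1, s2)) := rfl

@[fun_prop]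
lemma measurable_covParams (β : ℝ) : Measurable (covParams β) := by unfold covParams; fun_prop

/-- For fixed τ² the variances σ₁² and σ₂² enter by translation, and Σ₁₂ = βτ² is a dilation by β.
This Jacobian is the factor |β| in the prior. -/
lemma lintegral_comp_covParams {β : ℝ} (hβ : β ≠ 0) {f : ℝ × ℝ × ℝ → ℝ≥0∞} (hf : Measurable f) :
    ENNReal.ofReal |β| * ∫⁻ w, f (covParams β w) = ∫⁻ s, f s := by
  rw [lintegral_triple hf, lintegral_triple (by fun_prop)]
  calc _ = ENNReal.ofReal |β| * ∫⁻ τ, ∫⁻ a, ∫⁻ d, f (a, β * τ, d) := by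
        congr 1
        refine lintegral_congr fun τ => ?_
        rw [← lintegral_add_left_eq_self (fun a => ∫⁻ d, f (a, β * τ, d)) τ]
        refine lintegral_congr fun a => ?_
        rw [← lintegral_add_left_eq_self (fun d => f (τ + a, β * τ, d)) (β ^ 2 * τ)]
        rfl
    _ = ∫⁻ h, ∫⁻ a, ∫⁻ d, f (a, h, d) :=
        lintegral_comp_mul_left (fun h => ∫⁻ a, ∫⁻ d, f (a, h, d)) hβ
    _ = _ := by
        refine lintegral_lintegral_swap (Measurable.aemeasurable ?_)
        exact Measurable.lintegral_prod_right' (f := fun z : (ℝ × ℝ) × ℝ => f (z.1.2, z.1.1, z.2))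
          (by fun_prop)

/-- The precision `Ψ₀(β)` in coordinates. -/
def precTriple (ν₀ κ₀ ρ₀ β : ℝ) : ℝ × ℝ × ℝ :=
  (ν₀ * κ₀ ^ 2, ν₀ * κ₀ ^ 2 * (ρ₀ * β), ν₀ * κ₀ ^ 2 * β ^ 2)

lemma measurable_samplingDensity {n : ℕ} (y₁ y₂ : Fin n → ℝ) (β : ℝ) :
    Measurable fun θ : ℝ × ℝ × ℝ × ℝ × ℝ =>
      samplingDensity y₁ y₂ θ.1 θ.2.1 β θ.2.2.1 θ.2.2.2.1 θ.2.2.2.2 := by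
  unfold samplingDensity
  simp only [covModel_eq_symMat, normalDensity_symMat, Prod.mk.eta]
  fun_prop

lemma samplingDensity_nonneg {n : ℕ} (y₁ y₂ : Fin n → ℝ) {μ α β : ℝ} {w : ℝ × ℝ × ℝ}
    (hw : 0 < symDet (covParams β w)) :
    0 ≤ samplingDensity y₁ y₂ μ α β w.1 w.2.1 w.2.2 := by
  unfold samplingDensity
  refine Finset.prod_nonneg fun i _ => ?_
  rw [covModel_eq_symMat, normalDensity_symMat]
  have := Real.pi_pos
  positivity

lemma normK_eq_toReal (β ν₀ κ₀ ρ₀ : ℝ) : normK β ν₀ (precision ν₀ κ₀ ρ₀ β) =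
    (kernelInt β ν₀ (precTriple ν₀ κ₀ ρ₀ β)).toReal := by
  have hset : {s : ℝ × ℝ × ℝ | symMat s ∈ region β} = regionSet β := by
    ext s; exact symMat_mem_region_iff β s
  rw [normK, precision_eq_symMat, hset, kernelInt_eq_setLIntegral]
  simp_rw [iwKernel_symMat]
  rw [integral_eq_lintegral_of_nonneg_ae _ (measurable_kernel _ _).aestronglyMeasurable]
  · rfl
  · exact ae_restrict_of_forall_mem (measurableSet_regionSet β) fun s hs => kernel_nonneg hs.2.1

lemma integrableOn_iwKernel {β ν₀ κ₀ ρ₀ : ℝ}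
    (h : kernelInt β ν₀ (precTriple ν₀ κ₀ ρ₀ β) < ∞) :
    IntegrableOn (fun s => iwKernel ν₀ (precision ν₀ κ₀ ρ₀ β) (symMat s))
      {s : ℝ × ℝ × ℝ | symMat s ∈ region β} := by
  have hset : {s : ℝ × ℝ × ℝ | symMat s ∈ region β} = regionSet β := by
    ext s; exact symMat_mem_region_iff β s
  rw [precision_eq_symMat, hset]
  simp_rw [iwKernel_symMat]
  refine ⟨(measurable_kernel _ _).aestronglyMeasurable, ?_⟩
  rw [hasFiniteIntegral_iff_ofReal]
  · rwa [kernelInt_eq_setLIntegral] at h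
  · exact ae_restrict_of_forall_mem (measurableSet_regionSet β) fun s hs => kernel_nonneg hs.2.1

open Classical in
lemma jointDensity_eq {n : ℕ} (y₁ y₂ : Fin n → ℝ) (c ν₀ κ₀ ρ₀ β : ℝ)
    (θ : ℝ × ℝ × ℝ × ℝ × ℝ) : jointDensity y₁ y₂ c ν₀ κ₀ ρ₀ β θ =
    samplingDensity y₁ y₂ θ.1 θ.2.1 β θ.2.2.1 θ.2.2.2.1 θ.2.2.2.2 *
      (c * |β| * (normK β ν₀ (precision ν₀ κ₀ ρ₀ β))⁻¹ *
        (regionSet β).indicator (kernel ν₀ (precTriple ν₀ κ₀ ρ₀ β)) (covParams β θ.2.2)) := by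
  rw [jointDensity, priorParams, priorSigma, covModel_eq_symMat]
  simp only [Prod.mk.eta, symMat_mem_region_iff]
  by_cases h : covParams β θ.2.2 ∈ regionSet β
  · rw [if_pos h, Set.indicator_of_mem h]
    nth_rewrite 2 [precision_eq_symMat]
    rw [iwKernel_symMat, precTriple]
    ring
  · rw [if_neg h, Set.indicator_of_notMem h]
    ring

lemma measurable_jointDensity {n : ℕ} (y₁ y₂ : Fin n → ℝ) (c ν₀ κ₀ ρ₀ β : ℝ) :
    Measurable (jointDensity y₁ y₂ c ν₀ κ₀ ρ₀ β) := by
  have h : jointDensity y₁ y₂ c ν₀ κ₀ ρ₀ β = fun θ =>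
    samplingDensity y₁ y₂ θ.1 θ.2.1 β θ.2.2.1 θ.2.2.2.1 θ.2.2.2.2 *
      (c * |β| * (normK β ν₀ (precision ν₀ κ₀ ρ₀ β))⁻¹ *
        (regionSet β).indicator (kernel ν₀ (precTriple ν₀ κ₀ ρ₀ β)) (covParams β θ.2.2)) :=
    funext fun θ => jointDensity_eq y₁ y₂ c ν₀ κ₀ ρ₀ β θ
  rw [h]
  refine (measurable_samplingDensity y₁ y₂ β).mul (measurable_const.mul ?_)
  exact ((measurable_kernel _ _).indicator (measurableSet_regionSet β)).comp (by fun_prop)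

lemma jointDensity_nonneg {n : ℕ} (y₁ y₂ : Fin n → ℝ) {c : ℝ} (hc : 0 ≤ c) (ν₀ κ₀ ρ₀ β : ℝ)
    (θ : ℝ × ℝ × ℝ × ℝ × ℝ) : 0 ≤ jointDensity y₁ y₂ c ν₀ κ₀ ρ₀ β θ := by
  rw [jointDensity_eq]
  have hN : 0 ≤ normK β ν₀ (precision ν₀ κ₀ ρ₀ β) := by
    rw [normK_eq_toReal]; exact ENNReal.toReal_nonneg
  by_cases h : covParams β θ.2.2 ∈ regionSet β
  · rw [Set.indicator_of_mem h]
    have := kernel_nonneg (m := ν₀) (P := precTriple ν₀ κ₀ ρ₀ β) h.2.1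
    have := samplingDensity_nonneg y₁ y₂ (μ := θ.1) (α := θ.2.1) h.2.1
    positivity
  · rw [Set.indicator_of_notMem h]; simp

/-- The prior density already vanishes off the nonnegativity domain, so integrating over
`paramDomain` is the same as integrating over the whole space. -/
lemma mem_paramDomain_of_covParams {β : ℝ} (hβ : β ≠ 0) {θ : ℝ × ℝ × ℝ × ℝ × ℝ}
    (h : covParams β θ.2.2 ∈ regionSet β) : θ ∈ paramDomain := by
  obtain ⟨-, -, h3, h4, h5⟩ := h
  simp only [covParams] at h3 h4 h5
  rw [mul_div_cancel_left₀ _ hβ] at h3 h4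
  exact ⟨h3, by linarith, by nlinarith⟩

/-- This is the conjugacy of the inverted Wishart kernel: degrees of freedom and precision add. -/
lemma kernel_mul_kernel {m k : ℝ} {P S s : ℝ × ℝ × ℝ} (hD : 0 < symDet s) :
    symDet s ^ (-k / 2) * Real.exp (-(1 / 2) * (k * (S.1 * s.2.2 - 2 * S.2.1 * s.2.1 +
      S.2.2 * s.1) / symDet s)) * kernel m P s = kernel (m + k) (P + k • S) s := by
  simp only [kernel, Prod.fst_add, Prod.snd_add, Prod.smul_fst, Prod.smul_snd, smul_eq_mul]
  rw [show -(m + k + 3) / 2 = -k / 2 + -(m + 3) / 2 by ring, Real.rpow_add hD,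
    show ∀ a b c d : ℝ, a * b * (c * d) = a * c * (b * d) by intros; ring, ← Real.exp_add]
  congr 2
  ring

/-- Tonelli allows the location parameters to be integrated first for each fixed Σ, where conjugacy
applies; the variance parameters are then exchanged for Σ. Working with extended nonnegative values,
the identity needs no prior knowledge of convergence. -/
lemma lintegral_jointDensity {n : ℕ} (hn : 1 < n) (y₁ y₂ : Fin n → ℝ) {c : ℝ} (hc : 0 ≤ c)
    (ν₀ κ₀ ρ₀ : ℝ) {β : ℝ} (hβ : β ≠ 0) :
    ∫⁻ θ in paramDomain, ENNReal.ofReal (jointDensity y₁ y₂ c ν₀ κ₀ ρ₀ β θ) =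
      ENNReal.ofReal (c * ((2 * Real.pi)⁻¹ ^ n * (2 * Real.pi / n)) *
        (normK β ν₀ (precision ν₀ κ₀ ρ₀ β))⁻¹) *
      kernelInt β (ν₀ + ((n : ℝ) - 1))
        (precTriple ν₀ κ₀ ρ₀ β + ((n : ℝ) - 1) • covTriple y₁ y₂) := by
  have hpi := Real.pi_pos
  have hN : 0 ≤ (normK β ν₀ (precision ν₀ κ₀ ρ₀ β))⁻¹ := by
    rw [normK_eq_toReal]; exact inv_nonneg.2 ENNReal.toReal_nonneg
  set J : ℝ × ℝ × ℝ × ℝ × ℝ → ℝ≥0∞ := fun θ =>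
    ENNReal.ofReal (jointDensity y₁ y₂ c ν₀ κ₀ ρ₀ β θ) with hJ
  have hJm : Measurable J := (measurable_jointDensity y₁ y₂ c ν₀ κ₀ ρ₀ β).ennreal_ofReal
  have hdom : MeasurableSet paramDomain := by
    unfold paramDomain
    simp only [Set.ofPred_and]
    exact (measurableSet_le (f := fun _ : ℝ × ℝ × ℝ × ℝ × ℝ => (0 : ℝ)) (g := fun θ => θ.2.2.1)
        (by fun_prop) (by fun_prop)).inter <|
      (measurableSet_le (f := fun _ : ℝ × ℝ × ℝ × ℝ × ℝ => (0 : ℝ)) (g := fun θ => θ.2.2.2.1)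
        (by fun_prop) (by fun_prop)).inter
      (measurableSet_le (f := fun _ : ℝ × ℝ × ℝ × ℝ × ℝ => (0 : ℝ)) (g := fun θ => θ.2.2.2.2)
        (by fun_prop) (by fun_prop))
  calc ∫⁻ θ in paramDomain, J θ = ∫⁻ θ, J θ := by
        rw [← lintegral_indicator hdom]
        refine lintegral_congr fun θ => ?_
        by_cases hθ : θ ∈ paramDomain
        · rw [Set.indicator_of_mem hθ]
        · rw [Set.indicator_of_notMem hθ]
          simp only [hJ]
          rw [jointDensity_eq, Set.indicator_of_notMem
            (fun h => hθ (mem_paramDomain_of_covParams hβ h))]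
          simp
    _ = ∫⁻ μ, ∫⁻ α, ∫⁻ w, J (μ, α, w) := by
        rw [Measure.volume_eq_prod, lintegral_prod _ hJm.aemeasurable]
        refine lintegral_congr fun a => ?_
        rw [Measure.volume_eq_prod, lintegral_prod _ (by fun_prop)]
    _ = ∫⁻ μ, ∫⁻ w, ∫⁻ α, J (μ, α, w) :=
        lintegral_congr fun μ => lintegral_lintegral_swap (by fun_prop)
    _ = ∫⁻ w, ∫⁻ μ, ∫⁻ α, J (μ, α, w) := by
        refine lintegral_lintegral_swap (Measurable.aemeasurable ?_)
        exact Measurable.lintegral_prod_right'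
          (f := fun z : (ℝ × (ℝ × ℝ × ℝ)) × ℝ => J (z.1.1, z.2, z.1.2)) (by fun_prop)
    _ = ∫⁻ w, ENNReal.ofReal |β| * (ENNReal.ofReal (c * ((2 * Real.pi)⁻¹ ^ n *
          (2 * Real.pi / n)) * (normK β ν₀ (precision ν₀ κ₀ ρ₀ β))⁻¹) *
          kernelOn β (ν₀ + ((n : ℝ) - 1))
            (precTriple ν₀ κ₀ ρ₀ β + ((n : ℝ) - 1) • covTriple y₁ y₂) (covParams β w)) := by
        refine lintegral_congr fun w => ?_
        simp only [hJ, jointDensity_eq]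
        by_cases h : covParams β w ∈ regionSet β
        · have hk := kernel_nonneg (m := ν₀) (P := precTriple ν₀ κ₀ ρ₀ β) h.2.1
          have hD := h.2.1
          rw [Set.indicator_of_mem h, kernelOn, Set.indicator_of_mem h]
          simp_rw [ENNReal.ofReal_mul (samplingDensity_nonneg y₁ y₂ h.2.1),
            lintegral_mul_const' _ _ ENNReal.ofReal_ne_top]
          have := lintegral_location hn y₁ y₂ β h.1 h.2.1
          simp only [samplingDensity, covModel_eq_symMat, Prod.mk.eta]
          rw [this, ← ENNReal.ofReal_mul (by positivity), ← ENNReal.ofReal_mul (by positivity),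
            ← ENNReal.ofReal_mul (by positivity), ← kernel_mul_kernel h.2.1]
          congr 1
          simp only [covTriple]
          ring
        · rw [Set.indicator_of_notMem h, kernelOn, Set.indicator_of_notMem h]
          simp
    _ = _ := by
        rw [kernelInt, ← lintegral_comp_covParams hβ (measurable_kernelOn _ _ _),
          lintegral_const_mul' _ _ ENNReal.ofReal_ne_top,
          lintegral_const_mul' _ _ ENNReal.ofReal_ne_top, mul_left_comm]

lemma reducedDensity_eq {n : ℕ} (hn : 1 < n) (y₁ y₂ : Fin n → ℝ) {c : ℝ} (hc : 0 ≤ c)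
    (ν₀ κ₀ ρ₀ : ℝ) {β : ℝ} (hβ : β ≠ 0) :
    reducedDensity y₁ y₂ c ν₀ κ₀ ρ₀ β =
      c * ((2 * Real.pi)⁻¹ ^ n * (2 * Real.pi / n)) *
        (normK β ν₀ (precision ν₀ κ₀ ρ₀ β))⁻¹ *
      (kernelInt β (ν₀ + ((n : ℝ) - 1))
        (precTriple ν₀ κ₀ ρ₀ β + ((n : ℝ) - 1) • covTriple y₁ y₂)).toReal := by
  have hpi := Real.pi_pos
  have hN : 0 ≤ (normK β ν₀ (precision ν₀ κ₀ ρ₀ β))⁻¹ := by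
    rw [normK_eq_toReal]; exact inv_nonneg.2 ENNReal.toReal_nonneg
  rw [reducedDensity, integral_eq_lintegral_of_nonneg_ae
    (ae_of_all _ (jointDensity_nonneg y₁ y₂ hc ν₀ κ₀ ρ₀ β))
    (measurable_jointDensity y₁ y₂ c ν₀ κ₀ ρ₀ β).aestronglyMeasurable,
    lintegral_jointDensity hn y₁ y₂ hc ν₀ κ₀ ρ₀ hβ, ENNReal.toReal_mul,
    ENNReal.toReal_ofReal (by positivity)]

lemma integrableOn_jointDensity {n : ℕ} (hn : 1 < n) (y₁ y₂ : Fin n → ℝ) {c : ℝ} (hc : 0 ≤ c)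
    (ν₀ κ₀ ρ₀ : ℝ) {β : ℝ} (hβ : β ≠ 0)
    (hfin : kernelInt β (ν₀ + ((n : ℝ) - 1))
        (precTriple ν₀ κ₀ ρ₀ β + ((n : ℝ) - 1) • covTriple y₁ y₂) < ∞) :
    IntegrableOn (jointDensity y₁ y₂ c ν₀ κ₀ ρ₀ β) paramDomain := by
  refine ⟨(measurable_jointDensity y₁ y₂ c ν₀ κ₀ ρ₀ β).aestronglyMeasurable, ?_⟩
  rw [hasFiniteIntegral_iff_ofReal (ae_of_all _ (jointDensity_nonneg y₁ y₂ hc ν₀ κ₀ ρ₀ β)),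
    lintegral_jointDensity hn y₁ y₂ hc ν₀ κ₀ ρ₀ hβ]
  exact ENNReal.mul_lt_top ENNReal.ofReal_lt_top hfin

/-! ### Reduction to unit slope -/

/-- Dividing the second coordinate by β makes the region independent of β, so the slope survives
only in an explicit power and in the precision. -/
lemma kernelInt_eq_unit_slope {β : ℝ} (hβ : β ≠ 0) (m : ℝ) (P : ℝ × ℝ × ℝ) :
    kernelInt β m P = ENNReal.ofReal (|β| ^ (-m)) *
      kernelInt 1 m (P.1, P.2.1 / β, P.2.2 / β ^ 2) := by
  have h := kernelInt_scale β m P one_ne_zero hβ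
  simpa [div_self hβ] using h

lemma kernelInt_lt_top {β m : ℝ} (hβ : β ≠ 0) (hm : 0 < m) {P : ℝ × ℝ × ℝ} (hP : 0 < P.1)
    (hD : 0 < symDet P) : kernelInt β m P < ∞ := by
  rw [kernelInt_eq_unit_slope hβ]
  refine ENNReal.mul_lt_top ENNReal.ofReal_lt_top (kernelInt_one_lt_top hm hP ?_)
  have : symDet (P.1, P.2.1 / β, P.2.2 / β ^ 2) = symDet P / β ^ 2 := by
    simp only [symDet]; field_simp
  rw [this]; positivity

/-- The scaled sample covariances `ν (S₁₁, S₁₂/β, S₂₂/β²)`. -/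
def scaledCov (ν : ℝ) (S : ℝ × ℝ × ℝ) (β : ℝ) : ℝ × ℝ × ℝ :=
  (ν * S.1, ν * S.2.1 / β, ν * S.2.2 / β ^ 2)

/-- The reduced sampling density up to factors that do not depend on `β`. -/
def marginal (ν : ℝ) (S M : ℝ × ℝ × ℝ) (ν₀ β : ℝ) : ℝ :=
  |β| ^ (-ν) * (kernelInt 1 (ν + ν₀) (scaledCov ν S β + ν₀ • M)).toReal

lemma symDet_scaledCov (ν : ℝ) (S : ℝ × ℝ × ℝ) {β : ℝ} (hβ : β ≠ 0) :
    symDet (scaledCov ν S β) = ν ^ 2 * symDet S / β ^ 2 := by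
  simp only [symDet, scaledCov]; field_simp

lemma symDet_smul (k : ℝ) (S : ℝ × ℝ × ℝ) : symDet (k • S) = k ^ 2 * symDet S := by
  simp only [symDet, Prod.smul_fst, Prod.smul_snd, smul_eq_mul]; ring

lemma symDet_add_pos {P Q : ℝ × ℝ × ℝ} (hP : 0 < P.1) (hPD : 0 < symDet P) (hQ : 0 < Q.1)
    (hQD : 0 < symDet Q) : 0 < symDet (P + Q) := by
  have h1 := (posDef_symMat_iff P).2 ⟨hP, hPD⟩
  have h2 := (posDef_symMat_iff Q).2 ⟨hQ, hQD⟩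
  have h3 : symMat (P + Q) = symMat P + symMat Q := by
    ext i j; fin_cases i <;> fin_cases j <;> simp [symMat]
  exact ((posDef_symMat_iff (P + Q)).1 (h3 ▸ h1.add h2)).2

/-! ### Finiteness, measurability, positivity and a slope-uniform bound for the marginal factor. -/

section Marginal

variable {ν : ℝ} {S M : ℝ × ℝ × ℝ}

lemma kernelInt_scaledCov_lt_top (hν : 0 < ν) (hS : 0 < S.1) (hSD : 0 < symDet S) {β : ℝ}
    (hβ : β ≠ 0) : kernelInt 1 ν (scaledCov ν S β) < ∞ := by
  refine kernelInt_one_lt_top hν (mul_pos hν hS) ?_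
  rw [symDet_scaledCov ν S hβ]; positivity

/-- Since the region of integration is fixed at unit slope, β enters only through a jointly
measurable integrand. -/
lemma measurable_marginal (ν : ℝ) (S M : ℝ × ℝ × ℝ) (ν₀ : ℝ) : Measurable (marginal ν S M ν₀) := by
  unfold marginal
  refine Measurable.mul (by fun_prop) (Measurable.ennreal_toReal ?_)
  simp_rw [kernelInt_eq_setLIntegral]
  refine Measurable.lintegral_prod_right' (f := fun z : ℝ × (ℝ × ℝ × ℝ) =>
    ENNReal.ofReal (kernel (ν + ν₀) (scaledCov ν S z.1 + ν₀ • M) z.2)) ?_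
  refine Measurable.ennreal_ofReal ?_
  unfold kernel scaledCov
  fun_prop

lemma marginal_nonneg (ν : ℝ) (S M : ℝ × ℝ × ℝ) (ν₀ β : ℝ) : 0 ≤ marginal ν S M ν₀ β := by
  unfold marginal; positivity

lemma marginal_pos {ν₀ β : ℝ} (hβ : β ≠ 0)
    (hfin : kernelInt 1 (ν + ν₀) (scaledCov ν S β + ν₀ • M) < ∞) : 0 < marginal ν S M ν₀ β := by
  have := ENNReal.toReal_pos (kernelInt_pos (m := ν + ν₀) (scaledCov ν S β + ν₀ • M)).ne' hfin.ne
  have := abs_pos.2 hβ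
  unfold marginal; positivity

/-- The determinant of the scaled covariance is ν²|S|/β². Its power -ν/2 therefore grows like |β|^ν
and cancels the prefactor |β|^{-ν} exactly. -/
lemma exists_marginal_zero_le (hν : 0 < ν) (hS : 0 < S.1) (hSD : 0 < symDet S)
    (M : ℝ × ℝ × ℝ) : ∃ C, ∀ β ≠ 0, marginal ν S M 0 β ≤ C := by
  obtain ⟨C, hC⟩ := exists_kernelInt_one_le hν
  refine ⟨|C| * (ν ^ 2 * symDet S) ^ (-(ν / 2)), fun β hβ => ?_⟩
  have hb := abs_pos.2 hβ
  have hD : 0 < symDet (scaledCov ν S β) := by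
    rw [symDet_scaledCov ν S hβ]; positivity
  have h1 := hC (scaledCov ν S β) (mul_pos hν hS) hD
  have h2 : (kernelInt 1 ν (scaledCov ν S β)).toReal ≤
      |C| * symDet (scaledCov ν S β) ^ (-(ν / 2)) := by
    refine ENNReal.toReal_le_of_le_ofReal (by positivity) (h1.trans ?_)
    gcongr
    exact le_abs_self C
  unfold marginal
  rw [add_zero, zero_smul, add_zero]
  calc _ ≤ |β| ^ (-ν) * (|C| * symDet (scaledCov ν S β) ^ (-(ν / 2))) := by gcongr
    _ = _ := by
      rw [symDet_scaledCov ν S hβ, ← sq_abs β, Real.div_rpow (by positivity) (by positivity),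
        ← Real.rpow_natCast |β| 2, ← Real.rpow_mul hb.le]
      have : ((2 : ℕ) : ℝ) * -(ν / 2) = -ν := by push_cast; ring
      rw [this]
      have hne : |β| ^ (-ν) ≠ 0 := (Real.rpow_pos_of_pos hb _).ne'
      field_simp

end Marginal

/-! ### The noninformative limit of the prior factor -/

section Limit

variable {ν κ₀ ρ₀ : ℝ} {S : ℝ × ℝ × ℝ}

/-- With R = |Σ|^{1/2} and η = κ₀²(1 - |ρ₀|), one has tr(MΣ⁻¹) ≥ 2η/R. The left side is then at most
R⁻¹e^{-η/R}, which is bounded by 1/η. -/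
lemma rpow_symDet_mul_exp_le (hκ₀ : 0 < κ₀) (hρ₀ : -1 < ρ₀) (hρ₀' : ρ₀ < 1) {s : ℝ × ℝ × ℝ}
    (h1 : 0 < s.1) (hD : 0 < symDet s) :
    symDet s ^ (-(1 / 2) : ℝ) * Real.exp (-(1 / 2) * (((precTriple 1 κ₀ ρ₀ 1).1 * s.2.2 -
      2 * (precTriple 1 κ₀ ρ₀ 1).2.1 * s.2.1 + (precTriple 1 κ₀ ρ₀ 1).2.2 * s.1) / symDet s)) ≤
      (κ₀ ^ 2 * (1 - |ρ₀|))⁻¹ := by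
  obtain ⟨a, h, d⟩ := s
  simp only [precTriple, one_mul, mul_one, one_pow] at *
  have hρ : 0 < 1 - |ρ₀| := by
    have := abs_lt.2 ⟨hρ₀, hρ₀'⟩
    linarith
  set η := κ₀ ^ 2 * (1 - |ρ₀|) with hη
  have hη0 : 0 < η := by positivity
  have hDe : symDet (a, h, d) = a * d - h ^ 2 := rfl
  have hd : 0 < d := by
    have : 0 < a * d := by nlinarith [sq_nonneg h]
    exact pos_of_mul_pos_right this h1.le
  set D := symDet (a, h, d)
  set R := Real.sqrt D with hR
  have hR0 : 0 < R := Real.sqrt_pos.2 hD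
  have hRR : R * R = D := Real.mul_self_sqrt hD.le
  -- This is the arithmetic-geometric mean inequality in the form 4(ad - h²) ≤ (a + d)².
  have hRle : 2 * R ≤ a + d := by
    refine le_of_sq_le_sq ?_ (by positivity)
    nlinarith [sq_nonneg (a - d), sq_nonneg h]
  have hh : 2 * |h| ≤ a + d := by
    refine le_of_sq_le_sq ?_ (by positivity)
    rw [mul_pow, sq_abs]
    nlinarith [sq_nonneg (a - d)]
  -- The cross term costs at most |ρ₀|(a + d) because 2|h| ≤ a + d, leaving κ₀²(1 - |ρ₀|)(a + d),
  -- which is at least 2ηR.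
  have hU : 2 * η * R ≤ κ₀ ^ 2 * d - 2 * (κ₀ ^ 2 * ρ₀) * h + κ₀ ^ 2 * a := by
    have e1 : ρ₀ * h ≤ |ρ₀| * |h| := by rw [← abs_mul]; exact le_abs_self _
    have e2 : 2 * (ρ₀ * h) ≤ |ρ₀| * (a + d) := by nlinarith [abs_nonneg ρ₀]
    have e3 : (1 - |ρ₀|) * (2 * R) ≤ (1 - |ρ₀|) * (a + d) := by gcongr
    have e4 : (1 - |ρ₀|) * (2 * R) ≤ d - 2 * (ρ₀ * h) + a := by linarith
    nlinarith [mul_le_mul_of_nonneg_left e4 (sq_nonneg κ₀)]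
  have hle : -(1 / 2) * ((κ₀ ^ 2 * d - 2 * (κ₀ ^ 2 * ρ₀) * h + κ₀ ^ 2 * a) / D) ≤ -(η / R) := by
    have : 2 * (η / R) ≤ (κ₀ ^ 2 * d - 2 * (κ₀ ^ 2 * ρ₀) * h + κ₀ ^ 2 * a) / D := by
      rw [le_div_iff₀ hD, ← hRR]
      calc 2 * (η / R) * (R * R) = 2 * η * R := by field_simp
        _ ≤ _ := hU
    linarith
  have hexp : η / R ≤ Real.exp (η / R) := by linarith [Real.add_one_le_exp (η / R)]
  calc _ ≤ R⁻¹ * Real.exp (-(η / R)) := by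
        rw [Real.rpow_neg hD.le, ← Real.sqrt_eq_rpow]
        gcongr
    _ ≤ _ := by
        rw [Real.exp_neg, ← mul_inv]
        refine inv_anti₀ hη0 ?_
        calc η = R * (η / R) := by field_simp
          _ ≤ _ := by gcongr

/-- Conjugacy with increment ν₀ isolates the whole dependence on ν₀ in a single power. Pointwise
this power tends to 1, and a bound on its base gives a bound for every ν₀. -/
lemma kernel_add_eq (m ν₀ : ℝ) (P M : ℝ × ℝ × ℝ) {s : ℝ × ℝ × ℝ} (hD : 0 < symDet s) :
    kernel (m + ν₀) (P + ν₀ • M) s = (symDet s ^ (-(1 / 2) : ℝ) * Real.exp (-(1 / 2) *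
      ((M.1 * s.2.2 - 2 * M.2.1 * s.2.1 + M.2.2 * s.1) / symDet s))) ^ ν₀ * kernel m P s := by
  rw [← kernel_mul_kernel hD, Real.mul_rpow (by positivity) (by positivity),
    ← Real.rpow_mul hD.le, ← Real.exp_mul]
  congr 1
  congr 1
  · congr 1; ring
  · congr 1; ring

/-- Uniform bound for the prior factor as `ν₀` decreases to zero. -/
def priorBound (κ₀ ρ₀ : ℝ) : ℝ := max 1 (κ₀ ^ 2 * (1 - |ρ₀|))⁻¹

lemma priorBound_pos (κ₀ ρ₀ : ℝ) : 0 < priorBound κ₀ ρ₀ := lt_max_of_lt_left one_pos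

lemma priorBound_rpow_le (κ₀ ρ₀ : ℝ) {ν₀ : ℝ} (h1 : ν₀ ≤ 1) :
    priorBound κ₀ ρ₀ ^ ν₀ ≤ priorBound κ₀ ρ₀ := by
  have hB : 1 ≤ priorBound κ₀ ρ₀ := le_max_left _ _
  simpa using Real.rpow_le_rpow_of_exponent_le hB h1

lemma kernelOn_add_le (hκ₀ : 0 < κ₀) (hρ₀ : -1 < ρ₀) (hρ₀' : ρ₀ < 1) {ν₀ : ℝ} (h0 : 0 < ν₀)
    (m : ℝ) (P s : ℝ × ℝ × ℝ) :
    kernelOn 1 (m + ν₀) (P + ν₀ • precTriple 1 κ₀ ρ₀ 1) s ≤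
      ENNReal.ofReal (priorBound κ₀ ρ₀ ^ ν₀) * kernelOn 1 m P s := by
  have hB := priorBound_pos κ₀ ρ₀
  unfold kernelOn
  by_cases hs : s ∈ regionSet 1
  · rw [Set.indicator_of_mem hs, Set.indicator_of_mem hs,
      ← ENNReal.ofReal_mul (by positivity), kernel_add_eq m ν₀ P _ hs.2.1]
    refine ENNReal.ofReal_le_ofReal (mul_le_mul_of_nonneg_right ?_ (kernel_nonneg hs.2.1))
    have hD := hs.2.1
    refine Real.rpow_le_rpow (by positivity) ?_ h0.le
    exact (rpow_symDet_mul_exp_le hκ₀ hρ₀ hρ₀' hs.1 hs.2.1).trans (le_max_right _ _)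
  · rw [Set.indicator_of_notMem hs]; simp

/-- Dominated convergence: the integrand carries the factor A^{ν₀} → 1, and for 0 < ν₀ ≤ 1 this
factor is at most `priorBound`. -/
lemma tendsto_kernelInt_add (hκ₀ : 0 < κ₀) (hρ₀ : -1 < ρ₀) (hρ₀' : ρ₀ < 1) (m : ℝ)
    {P : ℝ × ℝ × ℝ} (hfin : kernelInt 1 m P < ∞) :
    Tendsto (fun ν₀ => kernelInt 1 (m + ν₀) (P + ν₀ • precTriple 1 κ₀ ρ₀ 1)) (𝓝[>] 0)
      (𝓝 (kernelInt 1 m P)) := by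
  have hev : ∀ᶠ ν₀ : ℝ in 𝓝[>] 0, ν₀ ∈ Set.Ioc (0 : ℝ) 1 := Ioc_mem_nhdsGT one_pos
  refine tendsto_lintegral_filter_of_dominated_convergence
    (fun s => ENNReal.ofReal (priorBound κ₀ ρ₀) * kernelOn 1 m P s)
    (Eventually.of_forall fun ν₀ => measurable_kernelOn _ _ _) ?_ ?_ ?_
  · filter_upwards [hev] with ν₀ hν₀
    refine ae_of_all _ fun s => (kernelOn_add_le hκ₀ hρ₀ hρ₀' hν₀.1 m P s).trans ?_
    gcongr
    exact priorBound_rpow_le κ₀ ρ₀ hν₀.2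
  · rw [lintegral_const_mul' _ _ ENNReal.ofReal_ne_top]
    exact (ENNReal.mul_lt_top ENNReal.ofReal_lt_top hfin).ne
  · refine ae_of_all _ fun s => ?_
    unfold kernelOn
    by_cases hs : s ∈ regionSet 1
    · simp only [Set.indicator_of_mem hs, kernel_add_eq m _ P _ hs.2.1]
      refine ENNReal.tendsto_ofReal ?_
      have hD := hs.2.1
      set A := symDet s ^ (-(1 / 2) : ℝ) * Real.exp (-(1 / 2) *
        (((precTriple 1 κ₀ ρ₀ 1).1 * s.2.2 - 2 * (precTriple 1 κ₀ ρ₀ 1).2.1 * s.2.1 +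
        (precTriple 1 κ₀ ρ₀ 1).2.2 * s.1) / symDet s)) with hA
      have hA0 : 0 < A := by positivity
      have : Tendsto (fun ν₀ : ℝ => A ^ ν₀ * kernel m P s) (𝓝 0) (𝓝 (A ^ (0 : ℝ) * kernel m P s)) :=
        ((Real.continuous_const_rpow hA0.ne').tendsto 0).mul_const _
      rw [Real.rpow_zero, one_mul] at this
      exact this.mono_left nhdsWithin_le_nhds
    · simp only [Set.indicator_of_notMem hs]
      exact tendsto_const_nhds

lemma tendsto_marginal (hκ₀ : 0 < κ₀) (hρ₀ : -1 < ρ₀) (hρ₀' : ρ₀ < 1) (hν : 0 < ν)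
    (hS : 0 < S.1) (hSD : 0 < symDet S) {β : ℝ} (hβ : β ≠ 0) :
    Tendsto (fun ν₀ => marginal ν S (precTriple 1 κ₀ ρ₀ 1) ν₀ β) (𝓝[>] 0)
      (𝓝 (marginal ν S (precTriple 1 κ₀ ρ₀ 1) 0 β)) := by
  have hfin := kernelInt_scaledCov_lt_top hν hS hSD hβ
  have h := (ENNReal.tendsto_toReal hfin.ne).comp
    (tendsto_kernelInt_add hκ₀ hρ₀ hρ₀' ν hfin)
  have h' := h.const_mul (|β| ^ (-ν))
  unfold marginal
  simpa using h'

lemma marginal_le (hκ₀ : 0 < κ₀) (hρ₀ : -1 < ρ₀) (hρ₀' : ρ₀ < 1) (hν : 0 < ν)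
    (hS : 0 < S.1) (hSD : 0 < symDet S) {β : ℝ} (hβ : β ≠ 0) {ν₀ : ℝ}
    (h0 : 0 < ν₀) : marginal ν S (precTriple 1 κ₀ ρ₀ 1) ν₀ β ≤
      priorBound κ₀ ρ₀ ^ ν₀ * marginal ν S (precTriple 1 κ₀ ρ₀ 1) 0 β := by
  have hfin := kernelInt_scaledCov_lt_top hν hS hSD hβ
  have hB : 0 ≤ priorBound κ₀ ρ₀ ^ ν₀ := Real.rpow_nonneg (priorBound_pos κ₀ ρ₀).le _
  unfold marginal
  rw [add_zero, zero_smul, add_zero, mul_left_comm]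
  refine mul_le_mul_of_nonneg_left ?_ (by positivity)
  rw [← ENNReal.toReal_ofReal hB, ← ENNReal.toReal_mul]
  refine ENNReal.toReal_mono (ENNReal.mul_lt_top ENNReal.ofReal_lt_top hfin).ne ?_
  unfold kernelInt
  rw [← lintegral_const_mul' _ _ ENNReal.ofReal_ne_top]
  exact lintegral_mono fun s => kernelOn_add_le hκ₀ hρ₀ hρ₀' h0 ν _ s

end Limit

/-! ### Integrals against the prior of the slope -/

section Slope

variable {ν κ₀ ρ₀ : ℝ} {S : ℝ × ℝ × ℝ} {p : ℝ → ℝ}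

lemma ae_ne_zero : ∀ᵐ β : ℝ, β ≠ 0 := by
  simp [ae_iff]

lemma kernelInt_scaledCov_add_lt_top (hκ₀ : 0 < κ₀) (hρ₀ : -1 < ρ₀) (hρ₀' : ρ₀ < 1) (hν : 0 < ν)
    (hS : 0 < S.1) (hSD : 0 < symDet S) {ν₀ : ℝ} (h0 : 0 ≤ ν₀) {β : ℝ} (hβ : β ≠ 0) :
    kernelInt 1 (ν + ν₀) (scaledCov ν S β + ν₀ • precTriple 1 κ₀ ρ₀ 1) < ∞ := by
  rcases h0.eq_or_lt with rfl | h0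
  · simpa using kernelInt_scaledCov_lt_top hν hS hSD hβ
  · refine lt_of_le_of_lt (lintegral_mono fun s => kernelOn_add_le hκ₀ hρ₀ hρ₀' h0 ν _ s) ?_
    rw [lintegral_const_mul' _ _ ENNReal.ofReal_ne_top]
    exact ENNReal.mul_lt_top ENNReal.ofReal_lt_top (kernelInt_scaledCov_lt_top hν hS hSD hβ)

lemma exists_marginal_le (hκ₀ : 0 < κ₀) (hρ₀ : -1 < ρ₀) (hρ₀' : ρ₀ < 1) (hν : 0 < ν)
    (hS : 0 < S.1) (hSD : 0 < symDet S) : ∃ C, ∀ ν₀, 0 ≤ ν₀ → ∀ β ≠ 0,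
      marginal ν S (precTriple 1 κ₀ ρ₀ 1) ν₀ β ≤ priorBound κ₀ ρ₀ ^ ν₀ * C := by
  obtain ⟨C, hC⟩ := exists_marginal_zero_le hν hS hSD (precTriple 1 κ₀ ρ₀ 1)
  refine ⟨C, fun ν₀ h0 β hβ => ?_⟩
  rcases h0.eq_or_lt with rfl | h0
  · simpa using hC β hβ
  · refine (marginal_le hκ₀ hρ₀ hρ₀' hν hS hSD hβ h0).trans ?_
    exact mul_le_mul_of_nonneg_left (hC β hβ) (Real.rpow_nonneg (priorBound_pos κ₀ ρ₀).le _)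

lemma integrable_marginal_mul (hκ₀ : 0 < κ₀) (hρ₀ : -1 < ρ₀) (hρ₀' : ρ₀ < 1) (hν : 0 < ν)
    (hS : 0 < S.1) (hSD : 0 < symDet S) (hp : ∀ β, 0 ≤ p β) (hp_int : Integrable p) {ν₀ : ℝ}
    (h0 : 0 ≤ ν₀) :
    Integrable fun β => marginal ν S (precTriple 1 κ₀ ρ₀ 1) ν₀ β * p β := by
  obtain ⟨C, hC⟩ := exists_marginal_le hκ₀ hρ₀ hρ₀' hν hS hSD
  refine (hp_int.const_mul (priorBound κ₀ ρ₀ ^ ν₀ * C)).mono'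
    ((measurable_marginal _ _ _ _).aestronglyMeasurable.mul hp_int.aestronglyMeasurable) ?_
  filter_upwards [ae_ne_zero] with β hβ
  rw [Real.norm_of_nonneg (mul_nonneg (marginal_nonneg _ _ _ _ _) (hp β))]
  exact mul_le_mul_of_nonneg_right (hC ν₀ h0 β hβ) (hp β)

/-- Off the null point β = 0 the product vanishes only where p does, and p has a support of positive
measure because its mass is one. -/
lemma integral_mul_pos {g : ℝ → ℝ} (hg : ∀ β, 0 ≤ g β) (hg' : ∀ β ≠ 0, 0 < g β)
    (hp : ∀ β, 0 ≤ p β) (hp_one : ∫ β, p β = 1) (hp_int : Integrable p)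
    (hint : Integrable fun β => g β * p β) : 0 < ∫ β, g β * p β := by
  rw [integral_pos_iff_support_of_nonneg (fun β => mul_nonneg (hg β) (hp β)) hint]
  have h1 : 0 < ∫ β, p β := by rw [hp_one]; exact one_pos
  rw [integral_pos_iff_support_of_nonneg hp hp_int] at h1
  refine h1.trans_le (measure_mono_ae ?_)
  filter_upwards [ae_ne_zero] with β hβ h
  exact mul_ne_zero (hg' β hβ).ne' h

/-- A second dominated convergence, now in β: the uniform bound on the marginal factor makes a
constant multiple of the proper prior a dominating function. -/
lemma tendsto_integral_marginal_mul (hκ₀ : 0 < κ₀) (hρ₀ : -1 < ρ₀) (hρ₀' : ρ₀ < 1) (hν : 0 < ν)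
    (hS : 0 < S.1) (hSD : 0 < symDet S) (hp : ∀ β, 0 ≤ p β) (hp_int : Integrable p) :
    Tendsto (fun ν₀ => ∫ β, marginal ν S (precTriple 1 κ₀ ρ₀ 1) ν₀ β * p β) (𝓝[>] 0)
      (𝓝 (∫ β, marginal ν S (precTriple 1 κ₀ ρ₀ 1) 0 β * p β)) := by
  obtain ⟨C, hC⟩ := exists_marginal_le hκ₀ hρ₀ hρ₀' hν hS hSD
  -- Evaluating the bound at ν₀ = 0 and β = 1 shows that the constant is nonnegative.
  have hC0 : 0 ≤ C := by
    have := (marginal_nonneg ν S (precTriple 1 κ₀ ρ₀ 1) 0 1).trans (hC 0 le_rfl 1 one_ne_zero)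
    simpa using this
  have hev : ∀ᶠ ν₀ : ℝ in 𝓝[>] 0, ν₀ ∈ Set.Ioc (0 : ℝ) 1 := Ioc_mem_nhdsGT one_pos
  refine tendsto_integral_filter_of_dominated_convergence
    (fun β => priorBound κ₀ ρ₀ * C * p β) ?_ ?_ (hp_int.const_mul _) ?_
  · exact Eventually.of_forall fun ν₀ =>
      (measurable_marginal _ _ _ _).aestronglyMeasurable.mul hp_int.aestronglyMeasurable
  · filter_upwards [hev] with ν₀ hν₀
    filter_upwards [ae_ne_zero] with β hβ
    rw [Real.norm_of_nonneg (mul_nonneg (marginal_nonneg _ _ _ _ _) (hp β))]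
    refine mul_le_mul_of_nonneg_right ((hC ν₀ hν₀.1.le β hβ).trans ?_) (hp β)
    exact mul_le_mul_of_nonneg_right (priorBound_rpow_le κ₀ ρ₀ hν₀.2) hC0
  · filter_upwards [ae_ne_zero] with β hβ
    exact (tendsto_marginal hκ₀ hρ₀ hρ₀' hν hS hSD hβ).mul_const _

end Slope

/-! ### The posterior in terms of the marginal factor -/

lemma covTriple_pos {n : ℕ} {y₁ y₂ : Fin n → ℝ} (hS : (covS y₁ y₂).PosDef) :
    0 < (covTriple y₁ y₂).1 ∧ 0 < symDet (covTriple y₁ y₂) :=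
  (posDef_symMat_iff (covTriple y₁ y₂)).1 hS

lemma precTriple_pos {ν₀ κ₀ ρ₀ β : ℝ} (h0 : 0 < ν₀) (hκ₀ : 0 < κ₀) (hρ₀ : -1 < ρ₀) (hρ₀' : ρ₀ < 1)
    (hβ : β ≠ 0) : 0 < (precTriple ν₀ κ₀ ρ₀ β).1 ∧ 0 < symDet (precTriple ν₀ κ₀ ρ₀ β) := by
  refine ⟨by simp only [precTriple]; positivity, ?_⟩
  have : symDet (precTriple ν₀ κ₀ ρ₀ β) = (ν₀ * κ₀ ^ 2 * β) ^ 2 * ((1 - ρ₀) * (1 + ρ₀)) := by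
    simp only [symDet, precTriple]; ring
  rw [this]
  have h1 : 0 < 1 - ρ₀ := by linarith
  have h2 : 0 < 1 + ρ₀ := by linarith
  positivity

/-- The `β`-free factor of the reduced sampling density. -/
def reducedConst (n : ℕ) (c ν₀ κ₀ ρ₀ : ℝ) : ℝ :=
  c * ((2 * Real.pi)⁻¹ ^ n * (2 * Real.pi / n)) *
    (kernelInt 1 ν₀ (precTriple ν₀ κ₀ ρ₀ 1)).toReal⁻¹

lemma reducedConst_pos {n : ℕ} (hn : 1 < n) {c ν₀ κ₀ ρ₀ : ℝ} (hc : 0 < c) (h0 : 0 < ν₀)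
    (hκ₀ : 0 < κ₀) (hρ₀ : -1 < ρ₀) (hρ₀' : ρ₀ < 1) : 0 < reducedConst n c ν₀ κ₀ ρ₀ := by
  have hpi := Real.pi_pos
  obtain ⟨h1, h2⟩ := precTriple_pos h0 hκ₀ hρ₀ hρ₀' one_ne_zero
  have := ENNReal.toReal_pos (kernelInt_pos (m := ν₀) (precTriple ν₀ κ₀ ρ₀ 1)).ne'
    (kernelInt_one_lt_top h0 h1 h2).ne
  have : (0 : ℝ) < n := by positivity
  unfold reducedConst
  positivity

/-- Ψ₀(β) is Ψ₀(1) conjugated by diag(1, β), so the reduction to unit slope leaves no β in the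
precision. The normalizing factor of the prior thus depends on β only through a power. -/
lemma toReal_kernelInt_precTriple (ν₀ κ₀ ρ₀ : ℝ) {β : ℝ} (hβ : β ≠ 0) :
    (kernelInt β ν₀ (precTriple ν₀ κ₀ ρ₀ β)).toReal =
      |β| ^ (-ν₀) * (kernelInt 1 ν₀ (precTriple ν₀ κ₀ ρ₀ 1)).toReal := by
  rw [kernelInt_eq_unit_slope hβ, ENNReal.toReal_mul, ENNReal.toReal_ofReal (by positivity)]
  congr 4
  simp only [precTriple]
  field_simp

/-- The power |β|^{-ν₀} from the prior normalization cancels against the same power in the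
numerator. All remaining prior normalization is β-free, so its behaviour as ν₀ ↓ 0 never has to be
known. -/
lemma reducedDensity_eq_marginal {n : ℕ} (hn : 1 < n) (y₁ y₂ : Fin n → ℝ) {c : ℝ} (hc : 0 ≤ c)
    (ν₀ κ₀ ρ₀ : ℝ) {β : ℝ} (hβ : β ≠ 0) :
    reducedDensity y₁ y₂ c ν₀ κ₀ ρ₀ β = reducedConst n c ν₀ κ₀ ρ₀ *
      marginal ((n : ℝ) - 1) (covTriple y₁ y₂) (precTriple 1 κ₀ ρ₀ 1) ν₀ β := by
  have hb := abs_pos.2 hβ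
  rw [reducedDensity_eq hn y₁ y₂ hc ν₀ κ₀ ρ₀ hβ, normK_eq_toReal,
    toReal_kernelInt_precTriple ν₀ κ₀ ρ₀ hβ, kernelInt_eq_unit_slope hβ, ENNReal.toReal_mul,
    ENNReal.toReal_ofReal (by positivity), reducedConst, marginal]
  have e1 : ((precTriple ν₀ κ₀ ρ₀ β + ((n : ℝ) - 1) • covTriple y₁ y₂).1,
      (precTriple ν₀ κ₀ ρ₀ β + ((n : ℝ) - 1) • covTriple y₁ y₂).2.1 / β,
      (precTriple ν₀ κ₀ ρ₀ β + ((n : ℝ) - 1) • covTriple y₁ y₂).2.2 / β ^ 2) =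
      scaledCov ((n : ℝ) - 1) (covTriple y₁ y₂) β + ν₀ • precTriple 1 κ₀ ρ₀ 1 := by
    ext <;> simp only [precTriple, covTriple, scaledCov, Prod.fst_add, Prod.snd_add, Prod.smul_fst,
      Prod.smul_snd, smul_eq_mul] <;> field_simp <;> ring
  have e2 : |β| ^ (-(ν₀ + ((n : ℝ) - 1))) = |β| ^ (-ν₀) * |β| ^ (-((n : ℝ) - 1)) := by
    rw [← Real.rpow_add hb]; congr 1; ring
  have hne : |β| ^ (-ν₀) ≠ 0 := (Real.rpow_pos_of_pos hb _).ne'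
  rw [e1, e2, add_comm ν₀, mul_inv (|β| ^ (-ν₀))]
  generalize |β| ^ (-ν₀) = u at hne
  calc _ = u⁻¹ * u * (c * ((2 * Real.pi)⁻¹ ^ n * (2 * Real.pi / n)) *
        (kernelInt 1 ν₀ (precTriple ν₀ κ₀ ρ₀ 1)).toReal⁻¹ * (|β| ^ (-((n : ℝ) - 1)) *
        (kernelInt 1 ((n : ℝ) - 1 + ν₀) (scaledCov ((n : ℝ) - 1) (covTriple y₁ y₂) β +
          ν₀ • precTriple 1 κ₀ ρ₀ 1)).toReal)) := by ring
    _ = _ := by rw [inv_mul_cancel₀ hne, one_mul]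

lemma posterior_eq {n : ℕ} (hn : 1 < n) (p : ℝ → ℝ) (y₁ y₂ : Fin n → ℝ) {c ν₀ κ₀ ρ₀ : ℝ}
    (hc : 0 < c) (h0 : 0 < ν₀) (hκ₀ : 0 < κ₀) (hρ₀ : -1 < ρ₀) (hρ₀' : ρ₀ < 1) {β : ℝ}
    (hβ : β ≠ 0) : posterior p y₁ y₂ c ν₀ κ₀ ρ₀ β =
      marginal ((n : ℝ) - 1) (covTriple y₁ y₂) (precTriple 1 κ₀ ρ₀ 1) ν₀ β * p β /
      ∫ b, marginal ((n : ℝ) - 1) (covTriple y₁ y₂) (precTriple 1 κ₀ ρ₀ 1) ν₀ b * p b := by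
  have hR := reducedConst_pos hn hc h0 hκ₀ hρ₀ hρ₀'
  have h1 : ∫ b, reducedDensity y₁ y₂ c ν₀ κ₀ ρ₀ b * p b = reducedConst n c ν₀ κ₀ ρ₀ *
      ∫ b, marginal ((n : ℝ) - 1) (covTriple y₁ y₂) (precTriple 1 κ₀ ρ₀ 1) ν₀ b * p b := by
    rw [← integral_const_mul]
    refine integral_congr_ae ?_
    filter_upwards [ae_ne_zero] with b hb
    rw [reducedDensity_eq_marginal hn y₁ y₂ hc.le ν₀ κ₀ ρ₀ hb, mul_assoc]
  rw [posterior, h1, reducedDensity_eq_marginal hn y₁ y₂ hc.le ν₀ κ₀ ρ₀ hβ, mul_assoc,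
    mul_div_mul_left _ _ hR.ne']

/-! ### Identification of the limit -/

lemma sampleCorr_sq_lt_one {n : ℕ} {y₁ y₂ : Fin n → ℝ} (hS : (covS y₁ y₂).PosDef) :
    sampleCorr y₁ y₂ ^ 2 < 1 := by
  obtain ⟨h1, h2⟩ := covTriple_pos hS
  simp only [covTriple, symDet] at h1 h2
  have h3 : 0 < sampleCov y₁ y₁ * sampleCov y₂ y₂ := by nlinarith [sq_nonneg (sampleCov y₁ y₂)]
  rw [sampleCorr, div_pow, Real.sq_sqrt h3.le, div_lt_one h3]
  linarith

lemma sampleCov_snd_pos {n : ℕ} {y₁ y₂ : Fin n → ℝ} (hS : (covS y₁ y₂).PosDef) :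
    0 < sampleCov y₂ y₂ := by
  obtain ⟨h1, h2⟩ := covTriple_pos hS
  simp only [covTriple, symDet] at h1 h2
  have h3 : 0 < sampleCov y₁ y₁ * sampleCov y₂ y₂ := by nlinarith [sq_nonneg (sampleCov y₁ y₂)]
  exact pos_of_mul_pos_right h3 h1.le

lemma sdRatio_pos {n : ℕ} {y₁ y₂ : Fin n → ℝ} (hS : (covS y₁ y₂).PosDef) :
    0 < sdRatio y₁ y₂ :=
  Real.sqrt_pos.2 (div_pos (sampleCov_snd_pos hS) (covTriple_pos hS).1)

lemma sign_sq {β : ℝ} (hβ : β ≠ 0) : Real.sign β ^ 2 = 1 := by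
  rcases Real.sign_apply_eq_of_ne_zero β hβ with h | h <;> rw [h] <;> norm_num

lemma mul_sign_sq_lt_one {r β : ℝ} (hr : r ^ 2 < 1) (hβ : β ≠ 0) : (r * Real.sign β) ^ 2 < 1 := by
  rwa [mul_pow, sign_sq hβ, mul_one]

/-- The factor depends on r through r² alone, so it is the same for both signs of the slope. -/
lemma halfConst_mul_sign (ν r : ℝ) {β : ℝ} (hβ : β ≠ 0) :
    halfConst ν (r * Real.sign β) = halfConst ν r := by
  unfold halfConst
  rw [mul_pow, sign_sq hβ, mul_one]

lemma kernelInt_corr_lt_top {ν r b : ℝ} (hν : 0 < ν) (hr : r ^ 2 < 1) (hb : 0 < b) :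
    kernelInt b ν (1, r, 1) < ∞ :=
  kernelInt_lt_top hb.ne' hν one_pos (by simp only [symDet]; linarith)

/-- Proportionality factor between the limit of the marginal factor and `J`. -/
def marginalConst {n : ℕ} (y₁ y₂ : Fin n → ℝ) : ℝ :=
  (Real.sqrt (((n : ℝ) - 1) * sampleCov y₁ y₁) * Real.sqrt (((n : ℝ) - 1) * sampleCov y₂ y₂)) ^
    (-((n : ℝ) - 1)) * halfConst ((n : ℝ) - 1) (sampleCorr y₁ y₂)

/-- At ν₀ = 0 the matrix M disappears. Standardizing the coordinates makes the precision a
correlation matrix, and the split into half regions supplies the two terms of J. -/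
lemma marginal_zero_eq_funJ {n : ℕ} (hn : 2 < n) {y₁ y₂ : Fin n → ℝ} (hS : (covS y₁ y₂).PosDef)
    (M : ℝ × ℝ × ℝ) {β : ℝ} (hβ : β ≠ 0) :
    marginal ((n : ℝ) - 1) (covTriple y₁ y₂) M 0 β = marginalConst y₁ y₂ *
      funJ β ((n : ℝ) - 1) (sampleCorr y₁ y₂) (sdRatio y₁ y₂) := by
  have hν : 1 < (n : ℝ) - 1 := by
    have : (2 : ℝ) < n := by exact_mod_cast hn
    linarith
  set ν := (n : ℝ) - 1 with hνdef
  have hν0 : 0 < ν := by linarith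
  have hS1 : 0 < sampleCov y₁ y₁ := (covTriple_pos hS).1
  have hS2 := sampleCov_snd_pos hS
  have hb := abs_pos.2 hβ
  have hl := sdRatio_pos hS
  have hr := mul_sign_sq_lt_one (sampleCorr_sq_lt_one hS) hβ
  have hsgn := sign_sq hβ
  have hs0 : Real.sign β ≠ 0 := fun h => by rw [h] at hsgn; norm_num at hsgn
  have hsabs : |Real.sign β| = 1 := by
    rcases Real.sign_apply_eq_of_ne_zero β hβ with h | h <;> rw [h] <;> norm_num
  set u := Real.sqrt (ν * sampleCov y₁ y₁) with hu
  set v := Real.sqrt (ν * sampleCov y₂ y₂) with hv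
  have hu0 : 0 < u := Real.sqrt_pos.2 (by positivity)
  have hv0 : 0 < v := Real.sqrt_pos.2 (by positivity)
  have hu2 : u ^ 2 = ν * sampleCov y₁ y₁ := Real.sq_sqrt (by positivity)
  have hv2 : v ^ 2 = ν * sampleCov y₂ y₂ := Real.sq_sqrt (by positivity)
  have hlv : sdRatio y₁ y₂ = v / u := by
    rw [sdRatio, hv, hu, ← Real.sqrt_div' _ (by positivity)]
    congr 1; field_simp
  have huv : u * v = ν * Real.sqrt (sampleCov y₁ y₁ * sampleCov y₂ y₂) := by
    rw [hu, hv, ← Real.sqrt_mul (by positivity),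
      show ν * sampleCov y₁ y₁ * (ν * sampleCov y₂ y₂) =
        ν ^ 2 * (sampleCov y₁ y₁ * sampleCov y₂ y₂) by ring, Real.sqrt_mul (by positivity),
      Real.sqrt_sq hν0.le]
  have hβs : β * Real.sign β = |β| := by
    rcases hβ.lt_or_gt with h | h
    · rw [Real.sign_of_neg h, abs_of_neg h, mul_neg_one]
    · rw [Real.sign_of_pos h, abs_of_pos h, mul_one]
  have e1 : marginal ν (covTriple y₁ y₂) M 0 β = (kernelInt β ν (ν • covTriple y₁ y₂)).toReal := by
    rw [kernelInt_eq_unit_slope hβ, ENNReal.toReal_mul, ENNReal.toReal_ofReal (by positivity),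
      marginal, add_zero, zero_smul, add_zero]
    rfl
  -- Scale by p = √(νS₁₁) and q = sign(β)√(νS₂₂). The magnitudes normalize the diagonal of νS, and
  -- the sign in q makes the slope positive at the price of replacing r by r sign β.
  have e2 : kernelInt β ν (ν • covTriple y₁ y₂) = ENNReal.ofReal ((u * v) ^ (-ν)) *
      kernelInt (|β| / sdRatio y₁ y₂) ν (1, sampleCorr y₁ y₂ * Real.sign β, 1) := by
    rw [kernelInt_scale β ν _ hu0.ne' (mul_ne_zero hs0 hv0.ne')]
    have a1 : |u * (Real.sign β * v)| = u * v := by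
      rw [abs_mul, abs_mul, hsabs, one_mul, abs_of_pos hu0, abs_of_pos hv0]
    have a2 : u * β / (Real.sign β * v) = |β| / sdRatio y₁ y₂ := by
      rw [hlv, ← hβs, div_eq_div_iff (by positivity) (by positivity)]
      field_simp
      linear_combination -hsgn
    have a3 : (ν • covTriple y₁ y₂).1 / u ^ 2 = 1 := by
      rw [hu2]; exact div_self (mul_pos hν0 hS1).ne'
    have a4 : (ν • covTriple y₁ y₂).2.2 / (Real.sign β * v) ^ 2 = 1 := by
      rw [mul_pow, hsgn, hv2, one_mul]; exact div_self (mul_pos hν0 hS2).ne'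
    have a5 : (ν • covTriple y₁ y₂).2.1 / (u * (Real.sign β * v)) =
        sampleCorr y₁ y₂ * Real.sign β := by
      rw [show u * (Real.sign β * v) = u * v * Real.sign β by ring, huv, sampleCorr]
      simp only [covTriple, Prod.smul_fst, Prod.smul_snd, smul_eq_mul]
      rw [div_eq_iff (by positivity)]
      field_simp
      linear_combination -sampleCov y₁ y₂ * hsgn
    rw [a1, a2, a3, a4, a5]
  have hbl : 0 < |β| / sdRatio y₁ y₂ := by positivity
  have hfin := kernelInt_corr_lt_top hν0 hr hbl
  rw [kernelInt_eq_halfInt_add hbl] at hfin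
  rw [e1, e2, ENNReal.toReal_mul, ENNReal.toReal_ofReal (by positivity),
    kernelInt_eq_halfInt_add hbl, ENNReal.toReal_add (lt_of_le_of_lt le_self_add hfin).ne
      (lt_of_le_of_lt le_add_self hfin).ne, toReal_halfInt hν hr hbl,
    toReal_halfInt hν hr (inv_pos.2 hbl), halfConst_mul_sign _ _ hβ, inv_div, funJ, marginalConst]
  ring

lemma marginalConst_pos {n : ℕ} (hn : 2 < n) {y₁ y₂ : Fin n → ℝ} (hS : (covS y₁ y₂).PosDef) :
    0 < marginalConst y₁ y₂ := by
  have hν : 1 < (n : ℝ) - 1 := by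
    have : (2 : ℝ) < n := by exact_mod_cast hn
    linarith
  have hν0 : 0 < (n : ℝ) - 1 := by linarith
  have hS1 : 0 < sampleCov y₁ y₁ := (covTriple_pos hS).1
  have hS2 := sampleCov_snd_pos hS
  have := halfConst_pos hν (sampleCorr_sq_lt_one hS)
  unfold marginalConst
  positivity

lemma intervalIntegrable_integrandI_of_pos {ν r b : ℝ} (hν : 1 < ν) (hr : r ^ 2 < 1) (hb : 0 < b) :
    IntervalIntegrable (integrandI b ν r) volume (tMinus ν r) (tPlus b ν r) := by
  refine intervalIntegrable_integrandI hν hr hb ?_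
  have hfin := kernelInt_corr_lt_top (by linarith) hr hb (ν := ν)
  rw [kernelInt_eq_halfInt_add hb] at hfin
  exact lt_of_le_of_lt le_self_add hfin

lemma integral_funJ_eq {n : ℕ} (hn : 2 < n) {y₁ y₂ : Fin n → ℝ} (hS : (covS y₁ y₂).PosDef)
    (M : ℝ × ℝ × ℝ) (p : ℝ → ℝ) :
    ∫ β, marginal ((n : ℝ) - 1) (covTriple y₁ y₂) M 0 β * p β = marginalConst y₁ y₂ *
      ∫ β, p β * funJ β ((n : ℝ) - 1) (sampleCorr y₁ y₂) (sdRatio y₁ y₂) := by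
  rw [← integral_const_mul]
  refine integral_congr_ae ?_
  filter_upwards [ae_ne_zero] with β hβ
  rw [marginal_zero_eq_funJ hn hS M hβ]
  ring

/-- The noninformative limit of the posterior density. -/
lemma tendsto_posterior {n : ℕ} (hn : 2 < n) {y₁ y₂ : Fin n → ℝ} (hS : (covS y₁ y₂).PosDef)
    {p : ℝ → ℝ} (hp : ∀ β, 0 ≤ p β) (hp_int : Integrable p) (hp_one : ∫ β, p β = 1)
    {c κ₀ ρ₀ : ℝ} (hc : 0 < c) (hκ₀ : 0 < κ₀) (hρ₀ : -1 < ρ₀) (hρ₀' : ρ₀ < 1) {β : ℝ}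
    (hβ : β ≠ 0) :
    Tendsto (fun ν₀ => posterior p y₁ y₂ c ν₀ κ₀ ρ₀ β) (𝓝[>] 0)
      (𝓝 (limitDensity p ((n : ℝ) - 1) (sampleCorr y₁ y₂) (sdRatio y₁ y₂) β)) := by
  have hν0 : 0 < (n : ℝ) - 1 := by
    have : (2 : ℝ) < n := by exact_mod_cast hn
    linarith
  obtain ⟨h1, h2⟩ := covTriple_pos hS
  have hQ := marginalConst_pos hn hS
  have hpos := integral_mul_pos (marginal_nonneg _ _ _ 0)
    (fun β hβ => marginal_pos hβ (kernelInt_scaledCov_add_lt_top hκ₀ hρ₀ hρ₀' hν0 h1 h2 le_rfl hβ))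
    hp hp_one hp_int (integrable_marginal_mul hκ₀ hρ₀ hρ₀' hν0 h1 h2 hp hp_int le_rfl)
  have hlim := ((tendsto_marginal hκ₀ hρ₀ hρ₀' hν0 h1 h2 hβ).mul_const (p β)).div
    (tendsto_integral_marginal_mul hκ₀ hρ₀ hρ₀' hν0 h1 h2 hp hp_int) hpos.ne'
  have heq : marginal ((n : ℝ) - 1) (covTriple y₁ y₂) (precTriple 1 κ₀ ρ₀ 1) 0 β * p β /
      ∫ b, marginal ((n : ℝ) - 1) (covTriple y₁ y₂) (precTriple 1 κ₀ ρ₀ 1) 0 b * p b =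
      limitDensity p ((n : ℝ) - 1) (sampleCorr y₁ y₂) (sdRatio y₁ y₂) β := by
    rw [integral_funJ_eq hn hS, marginal_zero_eq_funJ hn hS _ hβ, mul_assoc,
      mul_div_mul_left _ _ hQ.ne', limitDensity, mul_comm (p β)]
  rw [heq] at hlim
  refine hlim.congr' ?_
  filter_upwards [self_mem_nhdsWithin] with ν₀ h0
  exact (posterior_eq (by omega) p y₁ y₂ hc h0 hκ₀ hρ₀ hρ₀' hβ).symm

end EIV

end

/-! ### Assembly of the four claims. -/

theorem mainTheorem2
    (n : ℕ) (hn : 2 < n)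
    (y₁ y₂ : Fin n → ℝ) (hS : (EIV.covS y₁ y₂).PosDef)
    (p : ℝ → ℝ) (hp_nonneg : ∀ β, 0 ≤ p β) (hp_int : Integrable p) (hp_one : ∫ β, p β = 1)
    (c κ₀ ρ₀ : ℝ) (hc : 0 < c) (hκ₀ : 0 < κ₀) (hρ₀ : -1 < ρ₀) (hρ₀' : ρ₀ < 1) :
    -- for every `ν₀ > 0` the conditional prior of `Σ` and the posterior are well defined
    (∀ ν₀ : ℝ, 0 < ν₀ →
      (∀ β : ℝ, β ≠ 0 →
        IntegrableOn (fun s => EIV.iwKernel ν₀ (EIV.precision ν₀ κ₀ ρ₀ β) (EIV.symMat s))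
          {s : ℝ × ℝ × ℝ | EIV.symMat s ∈ EIV.region β} ∧
        0 < EIV.normK β ν₀ (EIV.precision ν₀ κ₀ ρ₀ β) ∧
        IntegrableOn (EIV.jointDensity y₁ y₂ c ν₀ κ₀ ρ₀ β) EIV.paramDomain) ∧
      Integrable (fun β => EIV.reducedDensity y₁ y₂ c ν₀ κ₀ ρ₀ β * p β) ∧
      0 < ∫ β, EIV.reducedDensity y₁ y₂ c ν₀ κ₀ ρ₀ β * p β) ∧
    -- the limiting density is well defined
    (Integrable (EIV.fDensity ((n : ℝ) - 1 + 1) ((n : ℝ) - 1 - 1)) ∧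
      (∀ β : ℝ, β ≠ 0 → ∀ b ∈ ({|β| / EIV.sdRatio y₁ y₂, EIV.sdRatio y₁ y₂ / |β|} : Set ℝ),
        IntervalIntegrable
          (EIV.integrandI b ((n : ℝ) - 1) (EIV.sampleCorr y₁ y₂ * Real.sign β)) volume
          (EIV.tMinus ((n : ℝ) - 1) (EIV.sampleCorr y₁ y₂ * Real.sign β))
          (EIV.tPlus b ((n : ℝ) - 1) (EIV.sampleCorr y₁ y₂ * Real.sign β))) ∧
      Integrable (fun β =>
        p β * EIV.funJ β ((n : ℝ) - 1) (EIV.sampleCorr y₁ y₂) (EIV.sdRatio y₁ y₂)) ∧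
      0 < ∫ β, p β * EIV.funJ β ((n : ℝ) - 1) (EIV.sampleCorr y₁ y₂) (EIV.sdRatio y₁ y₂)) ∧
    -- the noninformative limit
    (∀ β : ℝ, β ≠ 0 →
      Tendsto (fun ν₀ => EIV.posterior p y₁ y₂ c ν₀ κ₀ ρ₀ β) (𝓝[>] 0)
        (𝓝 (EIV.limitDensity p ((n : ℝ) - 1)
          (EIV.sampleCorr y₁ y₂) (EIV.sdRatio y₁ y₂) β))) ∧
    -- the limit depends on the data only through `r` and `l`: data with the same `r` and `l`
    -- lead to the same limit
    (∀ x₁ x₂ : Fin n → ℝ, (EIV.covS x₁ x₂).PosDef →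
      EIV.sampleCorr x₁ x₂ = EIV.sampleCorr y₁ y₂ → EIV.sdRatio x₁ x₂ = EIV.sdRatio y₁ y₂ →
      ∀ β : ℝ, β ≠ 0 →
        Tendsto (fun ν₀ => EIV.posterior p x₁ x₂ c ν₀ κ₀ ρ₀ β) (𝓝[>] 0)
          (𝓝 (EIV.limitDensity p ((n : ℝ) - 1)
            (EIV.sampleCorr y₁ y₂) (EIV.sdRatio y₁ y₂) β))) := by
  have hn2 : (2 : ℝ) < n := by exact_mod_cast hn
  have hν : 1 < (n : ℝ) - 1 := by linarith
  have hν0 : 0 < (n : ℝ) - 1 := by linarith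
  obtain ⟨h1, h2⟩ := EIV.covTriple_pos hS
  have hQ := EIV.marginalConst_pos hn hS
  refine ⟨fun ν₀ h0 => ⟨fun β hβ => ?_, ?_⟩, ⟨EIV.integrable_fDensity hν, ?_, ?_⟩, ?_, ?_⟩
  · obtain ⟨hP, hPD⟩ := EIV.precTriple_pos h0 hκ₀ hρ₀ hρ₀' hβ
    have hfin := EIV.kernelInt_lt_top hβ h0 hP hPD
    refine ⟨EIV.integrableOn_iwKernel hfin, ?_, ?_⟩
    -- Positivity is transferred from the unit-slope integral, which differs from the one at β by a
    -- power of |β|.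
    · obtain ⟨hP1, hPD1⟩ := EIV.precTriple_pos h0 hκ₀ hρ₀ hρ₀' one_ne_zero
      have := ENNReal.toReal_pos (EIV.kernelInt_pos (m := ν₀) (EIV.precTriple ν₀ κ₀ ρ₀ 1)).ne'
        (EIV.kernelInt_one_lt_top h0 hP1 hPD1).ne
      have hb := abs_pos.2 hβ
      rw [EIV.normK_eq_toReal, EIV.toReal_kernelInt_precTriple ν₀ κ₀ ρ₀ hβ]
      positivity
    · refine EIV.integrableOn_jointDensity (by omega) y₁ y₂ hc.le ν₀ κ₀ ρ₀ hβ
        (EIV.kernelInt_lt_top hβ (by linarith) ?_ ?_)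
      · exact add_pos hP (mul_pos hν0 h1)
      · refine EIV.symDet_add_pos hP hPD (mul_pos hν0 h1) ?_
        rw [EIV.symDet_smul]
        positivity
  · have hR := EIV.reducedConst_pos (n := n) (by omega) hc h0 hκ₀ hρ₀ hρ₀'
    have heq : (fun β => EIV.reducedDensity y₁ y₂ c ν₀ κ₀ ρ₀ β * p β) =ᵐ[volume] fun β =>
        EIV.reducedConst n c ν₀ κ₀ ρ₀ * (EIV.marginal ((n : ℝ) - 1) (EIV.covTriple y₁ y₂)
          (EIV.precTriple 1 κ₀ ρ₀ 1) ν₀ β * p β) := by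
      filter_upwards [EIV.ae_ne_zero] with β hβ
      rw [EIV.reducedDensity_eq_marginal (by omega) y₁ y₂ hc.le ν₀ κ₀ ρ₀ hβ, mul_assoc]
    have hint := EIV.integrable_marginal_mul hκ₀ hρ₀ hρ₀' hν0 h1 h2 hp_nonneg hp_int h0.le
    refine ⟨(hint.const_mul _).congr heq.symm, ?_⟩
    rw [integral_congr_ae heq, integral_const_mul]
    exact mul_pos hR (EIV.integral_mul_pos (EIV.marginal_nonneg _ _ _ _)
      (fun β hβ => EIV.marginal_pos hβ
        (EIV.kernelInt_scaledCov_add_lt_top hκ₀ hρ₀ hρ₀' hν0 h1 h2 h0.le hβ))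
      hp_nonneg hp_one hp_int hint)
  · intro β hβ b hb
    have hl := EIV.sdRatio_pos hS
    have hβ' := abs_pos.2 hβ
    refine EIV.intervalIntegrable_integrandI_of_pos hν
      (EIV.mul_sign_sq_lt_one (EIV.sampleCorr_sq_lt_one hS) hβ) ?_
    rcases hb with rfl | rfl <;> positivity
  · have hint := EIV.integrable_marginal_mul hκ₀ hρ₀ hρ₀' hν0 h1 h2 hp_nonneg hp_int le_rfl
    refine ⟨(hint.const_mul (EIV.marginalConst y₁ y₂)⁻¹).congr ?_, ?_⟩
    · filter_upwards [EIV.ae_ne_zero] with β hβ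
      rw [EIV.marginal_zero_eq_funJ hn hS _ hβ]
      field_simp
    · have hpos := EIV.integral_mul_pos (EIV.marginal_nonneg _ _ _ 0)
        (fun β hβ => EIV.marginal_pos hβ
          (EIV.kernelInt_scaledCov_add_lt_top hκ₀ hρ₀ hρ₀' hν0 h1 h2 le_rfl hβ))
        hp_nonneg hp_one hp_int hint
      rw [EIV.integral_funJ_eq hn hS] at hpos
      exact pos_of_mul_pos_right hpos hQ.le
  · exact fun β hβ => EIV.tendsto_posterior hn hS hp_nonneg hp_int hp_one hc hκ₀ hρ₀ hρ₀' hβ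
  · intro x₁ x₂ hx hr hl β hβ
    -- The limit formula for the second data set already has r and l as its only data inputs.
    rw [← hr, ← hl]
    exact EIV.tendsto_posterior hn hx hp_nonneg hp_int hp_one hc hκ₀ hρ₀ hρ₀' hβ
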